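/- Let $n\ge 0$, let $d\ge 0$ be even, let $r\ge 0$, and write $\mathcal S^k=\mathbb C[x_0,\dots,x_n]_k$ and $N=\binom{n+d/2}{n}=\dim \mathcal S^{d/2}$. Let $$\sigma_r(\mathrm{Sq}_{d,n})=\overline{\Big\{\sum_{i=1}^r g_i^2 \;\Big|\; g_i\in \mathcal S^{d/2}\Big\}}\subseteq \mathcal S^d$$ (Zariski closure) be the affine $r$-secant variety of the variety of squares. A form $F\in\mathcal S^d$ is called $\mathrm O(r)$-identifiable if $r$ is the smallest number of summands in a decomposition of $F$ as a sum of squares of elements of $\mathcal S^{d/2}$, and any two decompositions $F=\sum_{i=1}^r g_i^2=\sum_{i=1}^r h_i^2$ satisfy $h_i=\sum_j a_{ij}g_j$ for some complex orthogonal matrix $(a_{ij})\in\mathrm O(r)$. The variety $\sigma_r(\mathrm{Sq}_{d,n})$ is called generically $\mathrm O(r)$-identifiable if its general element is $\mathrm O(r)$-identifiable. **Theorem.** Let $(f_1,\dots,f_r)\in(\mathcal S^{d/2})^r$ be general, that is, outside a proper Zariski closed subset that depends only on $n,d,r$. Let $I_d=f_1\mathcal S^{d/2}+\dots+f_r\mathcal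 S^{d/2}$, assume $I_d\neq\mathcal S^d$, and let $H_1,\dots,H_m$ ($m\ge 1$) be a basis of the space $I_d^\perp$ of forms of degree $d$ in the dual variables that are orthogonal to $I_d$ with respect to the apolar product $\langle H,F\rangle = H(\partial_0,\dots,\partial_n)F$. Let $t_1,\dots,t_N$ be a basis of $\mathcal S^{d/2}$. If the $N\times mN$ stacked Hessian matrix $$\Big(\tfrac{\partial H_1}{\partial t_i\partial t_j}\,\Big|\,\cdots\,\Big|\,\tfrac{\partial H_m}{\partial t_i\partial t_j}\Big),\qquad \tfrac{\partial H_p}{\partial t_i\partial t_j}:=\langle H_p,t_it_j\rangle,$$ has rank $N-r$, then $\sigma_r(\mathrm{Sq}_{d,n})$ has dimension $rN-\binom r2$ and is generically $\mathrm O(r)$-identifiable. -/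

import Mathlib

open MvPolynomial

noncomputable section

namespace SumsOfSquares

/-! ### Zariski topology on a complex vector space -/

section Zariski

variable {E : Type*} [AddCommGroup E] [Module ℂ E]

/-- The point `x` of `E`, given by the values at `x` of all linear forms on `E`. Polynomial
functions on `E` are polynomials in the linear forms on `E`, evaluated at this family. -/
def linCoords (x : E) : Module.Dual ℂ E → ℂ := fun φ => φ x

/-- The ideal of all polynomial functions on `E` that vanish on `X`. -/
def idealOf (X : Set E) : Ideal (MvPolynomial (Module.Dual ℂ E) ℂ) :=
  MvPolynomial.vanishingIdeal ℂ (linCoords '' X)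

/-- The Zariski closure of `X`: the common zeros of all polynomial functions vanishing on `X`. -/
def zariskiClosure (X : Set E) : Set E :=
  {x | ∀ p ∈ idealOf X, MvPolynomial.eval (linCoords x) p = 0}

/-- `X` is the zero locus of a set of polynomial functions. -/
def IsZariskiClosed (X : Set E) : Prop := zariskiClosure X = X

/-- The property `P` holds at the general point of `X`: it holds at all points of a Zariski open
dense subset `X \ Z` of `X`. -/
def ForGeneral (X : Set E) (P : E → Prop) : Prop :=
  ∃ Z : Set E, IsZariskiClosed Z ∧ X ⊆ zariskiClosure (X \ Z) ∧ ∀ x ∈ X \ Z, P x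

/-- The dimension of a nonempty affine variety `X ⊆ E`: the transcendence degree over `ℂ` of its
coordinate ring. -/
def affineDim (X : Set E) : Cardinal :=
  Algebra.trdeg ℂ (MvPolynomial (Module.Dual ℂ E) ℂ ⧸ idealOf X)

end Zariski

/-! ### Forms and sums of squares -/

/-- `S^k ℂ^{n+1}`: homogeneous polynomials of degree `k` in `x_0, …, x_n`. -/
abbrev Forms (n k : ℕ) : Submodule ℂ (MvPolynomial (Fin (n + 1)) ℂ) :=
  MvPolynomial.homogeneousSubmodule (Fin (n + 1)) ℂ k

/-- `F = g_1 ^ 2 + ⋯ + g_r ^ 2`, with `g_i` of degree `d / 2`. -/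
def IsDecomposition {n d r : ℕ} (F : Forms n d) (g : Fin r → Forms n (d / 2)) : Prop :=
  (F : MvPolynomial (Fin (n + 1)) ℂ) = ∑ i, (g i : MvPolynomial (Fin (n + 1)) ℂ) ^ 2

/-- The forms of degree `d` that are sums of `r` squares (some of which may be zero). -/
def sumsOfSquares (n d r : ℕ) : Set (Forms n d) :=
  {F | ∃ g : Fin r → Forms n (d / 2), IsDecomposition F g}

/-- The affine `r`-secant variety `σ_r(Sq_{d,n})` of the variety of squares. -/
def secantVariety (n d r : ℕ) : Set (Forms n d) := zariskiClosure (sumsOfSquares n d r)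

/-- `F` has `2`-rank `r`. -/
def HasTwoRank {n d : ℕ} (F : Forms n d) (r : ℕ) : Prop :=
  IsLeast {s | F ∈ sumsOfSquares n d s} r

/-- `F` has a minimal decomposition with `r` summands, and any two decompositions of `F` as a sum of
`r` squares lie in the same orbit of the complex orthogonal group `O(r)`. -/
def IsOrthIdentifiable {n d : ℕ} (r : ℕ) (F : Forms n d) : Prop :=
  HasTwoRank F r ∧
    ∀ g h : Fin r → Forms n (d / 2), IsDecomposition F g → IsDecomposition F h →
      ∃ A ∈ Matrix.orthogonalGroup (Fin r) ℂ, ∀ i, h i = ∑ j, A i j • g j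

/-- The general element of `σ_r(Sq_{d,n})` is `O(r)`-identifiable. -/
def IsGenericallyOrthIdentifiable (n d r : ℕ) : Prop :=
  ForGeneral (secantVariety n d r) (fun F => IsOrthIdentifiable r F)

/-! ### Apolarity and the stacked Hessian matrix -/

/-- `I_d = f_1 S^{d/2} + ⋯ + f_r S^{d/2}`. -/
def idealPart {n d r : ℕ} (f : Fin r → Forms n (d / 2)) :
    Submodule ℂ (MvPolynomial (Fin (n + 1)) ℂ) :=
  ⨆ i, (Forms n (d / 2)).map
    (LinearMap.mulLeft ℂ (f i : MvPolynomial (Fin (n + 1)) ℂ))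

/-- The apolar product: the bilinear form with `⟨x^α, x^β⟩ = α!` if `α = β` and `0` otherwise. For
forms `D` and `F` of the same degree, `⟨D, F⟩` is the scalar `D(∂/∂x_0, …, ∂/∂x_n) F`. -/
def apolar (n : ℕ) :
    MvPolynomial (Fin (n + 1)) ℂ →ₗ[ℂ] MvPolynomial (Fin (n + 1)) ℂ →ₗ[ℂ] ℂ :=
  (MvPolynomial.basisMonomials (Fin (n + 1)) ℂ).constr ℂ
    (fun α => ((∏ i, (α i).factorial : ℕ) : ℂ) • MvPolynomial.lcoeff ℂ α)

/-- `I_d^⊥`: the forms `H` of degree `d` (in the dual variables) with `⟨H, F⟩ = 0` for all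
`F ∈ I_d`, that is, the hyperplanes of `S^d` that contain `I_d`. -/
def apolarPerp {n d r : ℕ} (f : Fin r → Forms n (d / 2)) :
    Submodule ℂ (MvPolynomial (Fin (n + 1)) ℂ) :=
  Forms n d ⊓ (idealPart f).dualAnnihilator.comap (apolar n)

/-- The stacked Hessian matrix `(∂H_1/∂t_i∂t_j | ⋯ | ∂H_m/∂t_i∂t_j)`. The product `t_i t_j`, as a
differential operator of degree `d`, takes `H_p` to the scalar `⟨H_p, t_i t_j⟩`. -/
def stackedHessian {n d r N m : ℕ} {f : Fin r → Forms n (d / 2)}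
    (t : Module.Basis (Fin N) ℂ (Forms n (d / 2)))
    (H : Module.Basis (Fin m) ℂ (apolarPerp f)) :
    Matrix (Fin N) (Fin m × Fin N) ℂ :=
  Matrix.of fun i pj =>
    apolar n (H pj.1 : MvPolynomial (Fin (n + 1)) ℂ)
      ((t i : MvPolynomial (Fin (n + 1)) ℂ) * (t pj.2 : MvPolynomial (Fin (n + 1)) ℂ))

end SumsOfSquares

end

open MvPolynomial

noncomputable section

namespace SumsOfSquares

/-! ### Rank of matrices under specialization -/

/-! Let X be the closure of the image of f ↦ F = ∑ f_i², and T_F the Zariski tangent space of X at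
F, cut out by generators of the ideal of X. The differential at f has image I_d(f), so I_d(f) ⊆ T_F
for every f, with equality for general f (`range_sqDiff_le_tangentSpace`,
`exists_tangentSpace_eq_range`).

The proof rests on the space K(F) = {u : uv ∈ T_F for all v}, which depends on F alone. If F = ∑
h_i² is any decomposition whatsoever, then h_i v ∈ I_d(h) ⊆ T_F, so every h_i lies in K(F). The
Hessian hypothesis at one general f₀ says that dim K(F₀) ≤ r. Since K is the kernel of a matrix of
polynomials in F, the bound holds on a nonempty open subset of X and at its generic point.

Identifiability: a general F in X has a decomposition f that is linearly independent and satisfies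
no quadratic relation. Then K(F) is the span of f, so h = Bf for any other decomposition h, and ∑
h_i² = ∑ f_i² makes BᵀB − 1 a quadratic relation among the f_i; hence B is orthogonal
(`sqSum_identifiable`).

Dimension: at the generic tuple x, T is the image of the differential. If ∑ x_i u_i = 0, a
derivation D with D x = u kills F. Differentiating along D the equations saying that x_i v is
tangent shows u_i ∈ K(F), so u = Sx. The absence of quadratic relations makes S skew, so the kernel
has dimension r(r−1)/2.

Quadratic relations are excluded as follows: differentiating one among the generic x_i twice puts a
nonzero multiple of each product t_a t_b into the module generated by the multiples of the x_i. Then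
I_d is everything for general f, against m ≥ 1 (`exists_range_eq_top`). -/

theorem exists_submatrix_rank_eq {m n L : Type} [Fintype m] [Fintype n] [Field L]
    (G : Matrix m n L) (k : ℕ) (hk : G.rank = k) :
    ∃ p : Fin k → m, (G.submatrix p id).rank = k := by
  rw [Matrix.rank_eq_finrank_span_row] at hk
  subst hk
  obtain ⟨f, hf, hs, hi⟩ := Submodule.exists_fun_fin_finrank_span_eq L (Set.range G.row)
  choose p hp using hf
  refine ⟨p, ?_⟩
  have : LinearIndependent L (G.submatrix p id).row := by
    have e : (G.submatrix p id).row = f := funext hp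
    rwa [e]
  rw [this.rank_matrix, Fintype.card_fin]

theorem exists_submatrix_det_ne_zero {m n L : Type} [Fintype m] [Fintype n] [Field L]
    (G : Matrix m n L) :
    ∃ (p : Fin G.rank → m) (q : Fin G.rank → n), (G.submatrix p q).det ≠ 0 := by
  obtain ⟨p, hp⟩ := exists_submatrix_rank_eq G _ rfl
  obtain ⟨q, hq⟩ := exists_submatrix_rank_eq (G.submatrix p id).transpose _
    ((Matrix.rank_transpose _).trans hp)
  refine ⟨p, q, ?_⟩
  have : LinearIndependent L (G.submatrix p q).transpose.row := by
    rw [linearIndependent_iff_card_eq_finrank_span, Set.finrank, ← Matrix.rank_eq_finrank_span_row]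
    simpa using hq.symm
  rw [← Matrix.det_transpose, ← isUnit_iff_ne_zero, ← Matrix.isUnit_iff_isUnit_det]
  exact Matrix.linearIndependent_rows_iff_isUnit.1 this

/-- Lower semicontinuity of rank: `a` is a minor witnessing the rank under `e`. The target field
varies so that a bound can pass between complex points and the generic point. -/
theorem rank_specialization {m n R₀ L : Type} [Fintype m] [Fintype n] [CommRing R₀] [Field L]
    (G : Matrix m n R₀) (e : R₀ →+* L) :
    ∃ a : R₀, e a ≠ 0 ∧ ∀ (L' : Type) [Field L'] (e' : R₀ →+* L'), e' a ≠ 0 →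
      (G.map e).rank ≤ (G.map e').rank := by
  obtain ⟨p, q, h⟩ := exists_submatrix_det_ne_zero (G.map e)
  refine ⟨(G.submatrix p q).det, by rwa [RingHom.map_det], fun L' _ e' h' => ?_⟩
  rw [RingHom.map_det] at h'
  have h1 := Matrix.rank_of_det_ne_zero h'
  have h2 := Matrix.rank_submatrix_le (G.map e') p q
  rw [Fintype.card_fin] at h1
  rw [← h1]
  exact h2

theorem finrank_ker_mulVecLin_add_rank {m n L : Type} [Fintype m] [Fintype n] [Field L]
    (G : Matrix m n L) :
    Module.finrank L (LinearMap.ker G.mulVecLin) + G.rank = Fintype.card n := by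
  rw [add_comm, Matrix.rank, LinearMap.finrank_range_add_finrank_ker, Module.finrank_pi]

/-! ### Extending derivations in characteristic zero -/

/-- Formally smooth field extensions lift along nilpotent thickenings. -/
theorem exists_section_of_formallySmooth {F K B : Type} [Field F] [Field K] [Algebra F K]
    [Algebra.FormallySmooth F K] [CommRing B] (g : F →+* B) (π : B →+* K)
    (hπ : Function.Surjective π) (hn : IsNilpotent (RingHom.ker π))
    (h : π.comp g = algebraMap F K) :
    ∃ s : K →+* B, π.comp s = RingHom.id K ∧ s.comp (algebraMap F K) = g := by
  let _ := g.toAlgebra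
  let π' : B →ₐ[F] K := { π with commutes' := fun x => DFunLike.congr_fun h x }
  let s := Algebra.FormallySmooth.liftOfSurjective (AlgHom.id F K) π' hπ hn
  refine ⟨s.toRingHom, RingHom.ext fun x => ?_, RingHom.ext fun x => s.commutes x⟩
  exact Algebra.FormallySmooth.liftOfSurjective_apply (AlgHom.id F K) π' hπ hn x

/-- In characteristic zero, a first-order deformation of an embedding `A → K` of a domain in a
finitely generated field extends to a derivation of `K`. -/
theorem exists_derivation_extending {k A K : Type} [Field k] [CharZero k] [CommRing A] [IsDomain A]
    [Field K] [Algebra k A] [Algebra k K] [Algebra.EssFiniteType k K]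
    (φ : A →ₐ[k] K) (hφ : Function.Injective φ) (g : A →ₐ[k] TrivSqZeroExt K K)
    (hg : ∀ a, (g a).fst = φ a) :
    ∃ D : Derivation k K K, ∀ a, D (φ a) = (g a).snd := by
  -- A dual number is invertible as soon as its first component is, so the deformation extends to
  -- the fraction field `F` of `A`.
  have hu : ∀ y : nonZeroDivisors A, IsUnit (g y) := fun y => by
    rw [TrivSqZeroExt.isUnit_iff_isUnit_fst, hg, isUnit_iff_ne_zero]
    exact (map_ne_zero_iff φ hφ).2 (nonZeroDivisors.ne_zero y.2)
  have hu' : ∀ y : nonZeroDivisors A, IsUnit (φ y) := fun y => by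
    rw [isUnit_iff_ne_zero]
    exact (map_ne_zero_iff φ hφ).2 (nonZeroDivisors.ne_zero y.2)
  let F := FractionRing A
  let φF : F →ₐ[k] K := IsLocalization.liftAlgHom (M := nonZeroDivisors A) (f := φ) hu'
  let gF : F →ₐ[k] TrivSqZeroExt K K :=
    IsLocalization.liftAlgHom (M := nonZeroDivisors A) (f := g) hu
  have hφF : ∀ a, φF (algebraMap A F a) = φ a := fun a => by simp [φF, F]
  have hgF : ∀ a, gF (algebraMap A F a) = g a := fun a => by simp [gF, F]
  have hfst : ∀ x, (gF x).fst = φF x := by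
    have : (TrivSqZeroExt.fstHom k K K).comp gF = φF := by
      apply IsLocalization.algHom_ext (nonZeroDivisors A)
      ext a
      change (gF (algebraMap A F a)).fst = φF (algebraMap A F a)
      rw [hgF, hφF, hg]
    intro x
    exact DFunLike.congr_fun this x
  let _ := φF.toRingHom.toAlgebra
  have : IsScalarTower k F K := IsScalarTower.of_algebraMap_eq fun x => (φF.commutes x).symm
  have : Algebra.EssFiniteType F K := Algebra.EssFiniteType.of_comp k F K
  have : CharZero F := charZero_of_injective_algebraMap (algebraMap k F).injective
  have : Algebra.FormallySmooth F K := Algebra.FormallySmooth.of_perfectField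
  -- `K` is formally smooth over `F` in characteristic zero, so the identity of `K` lifts to a ring
  -- map into the dual numbers compatible with `gF`. Its second component is the derivation.
  obtain ⟨s, hs1, hs2⟩ := exists_section_of_formallySmooth (F := F) (K := K) gF.toRingHom
    (TrivSqZeroExt.fstHom K K K).toRingHom (fun x => ⟨TrivSqZeroExt.inl x, by simp⟩)
    ⟨2, TrivSqZeroExt.kerIdeal_sq K K⟩ (RingHom.ext hfst)
  have hs1' : ∀ x, (s x).fst = x := fun x => DFunLike.congr_fun hs1 x
  have hs2' : ∀ a, s (φ a) = g a := fun a => by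
    rw [← hφF, ← hgF]; exact DFunLike.congr_fun hs2 (algebraMap A F a)
  have hk : ∀ c : k, s (algebraMap k K c) = TrivSqZeroExt.inl (algebraMap k K c) := fun c => by
    rw [← φ.commutes, hs2', g.commutes, φ.commutes]; rfl
  let lin : K →ₗ[k] K :=
    { toFun := fun x => (s x).snd
      map_add' := fun x y => by simp
      map_smul' := fun c x => by
        rw [Algebra.smul_def, map_mul, hk]
        simp [Algebra.smul_def] }
  refine ⟨Derivation.mk' lin fun a b => ?_, fun a => ?_⟩
  · change (s (a * b)).snd = a • (s b).snd + b • (s a).snd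
    rw [map_mul, TrivSqZeroExt.snd_mul, hs1', hs1']
    simp [mul_comm]
  · change (s (φ a)).snd = _
    rw [hs2']

/-! ### Images of polynomial maps -/

/-- A polynomial map `ℂ^σ → ℂ^ι` restricted to a nonempty open set `b ≠ 0` covers a nonempty open
subset of the closure of its image. -/
theorem exists_open_subset_image {σ ι : Type} [Finite σ] [Finite ι] (F : ι → MvPolynomial σ ℂ)
    (b : MvPolynomial σ ℂ) (hb : b ≠ 0) :
    ∃ a : MvPolynomial ι ℂ, aeval F a ≠ 0 ∧ ∀ y : ι → ℂ,
      (∀ p : MvPolynomial ι ℂ, aeval F p = 0 → aeval y p = 0) →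
      aeval y a ≠ 0 → ∃ f : σ → ℂ, (∀ β, aeval f (F β) = y β) ∧ aeval f b ≠ 0 := by
  let ψ : MvPolynomial ι ℂ →+* MvPolynomial σ ℂ := (aeval F).toRingHom
  have hψ : ψ.FinitePresentation := by
    refine RingHom.FinitePresentation.of_finiteType.1 ?_
    have : (ψ.comp (algebraMap ℂ (MvPolynomial ι ℂ))).FiniteType := by
      have e : ψ.comp (algebraMap ℂ (MvPolynomial ι ℂ)) = algebraMap ℂ (MvPolynomial σ ℂ) :=
        RingHom.ext fun x => (aeval F).commutes x
      rw [e, RingHom.finiteType_algebraMap]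
      infer_instance
    exact this.of_comp_finiteType
  have hc : Topology.IsConstructible (PrimeSpectrum.comap ψ '' (PrimeSpectrum.basicOpen b : Set _)) :=
    PrimeSpectrum.isConstructible_comap_image hψ PrimeSpectrum.isConstructible_basicOpen
  obtain ⟨S, hS⟩ := PrimeSpectrum.exists_constructibleSetData_iff.2 hc
  -- By Chevalley the image is a finite union of pieces V(g) ∩ D(f). The piece containing the image
  -- of the generic point has all its g in the kernel, so it contains the part of the closure where
  -- f does not vanish.
  have h0 : PrimeSpectrum.comap ψ ⊥ ∈ S.toSet := by
    rw [hS]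
    exact ⟨⊥, by simpa using hb, rfl⟩
  simp only [PrimeSpectrum.ConstructibleSetData.toSet, Set.mem_iUnion] at h0
  obtain ⟨D, hCS, hC⟩ := h0
  have hg : ∀ i, aeval F (D.g i) = 0 := fun i => by
    have : ψ (D.g i) = 0 := by simpa using hC.1 (Set.mem_range_self i)
    exact this
  refine ⟨D.f, fun h => hC.2 ?_, fun y hy hya => ?_⟩
  · have h' : ψ D.f = 0 := h
    simpa using h'
  have hm : (vanishingIdeal ℂ {y} : Ideal (MvPolynomial ι ℂ)).IsPrime := inferInstance
  have hmem : (⟨vanishingIdeal ℂ {y}, hm⟩ : PrimeSpectrum (MvPolynomial ι ℂ)) ∈ S.toSet := by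
    simp only [PrimeSpectrum.ConstructibleSetData.toSet, Set.mem_iUnion]
    refine ⟨D, hCS, ?_, ?_⟩
    · rintro _ ⟨i, rfl⟩
      simpa using hy _ (hg i)
    · simpa using hya
  rw [hS] at hmem
  obtain ⟨Q, hQb, hQ⟩ := hmem
  have hQ' : ∀ p : MvPolynomial ι ℂ, aeval y p = 0 → ψ p ∈ Q.asIdeal := fun p hp => by
    have : p ∈ (PrimeSpectrum.comap ψ Q).asIdeal := by
      rw [hQ]
      simpa using hp
    exact this
  -- The preimage `Q` is only a prime. The Jacobson property gives a maximal ideal above it that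
  -- avoids `b`, and by the Nullstellensatz that ideal is a point of ℂ^σ.
  have hj : b ∉ Q.asIdeal.jacobson := by
    rw [IsJacobsonRing.out inferInstance Q.2.isRadical]
    exact hQb
  rw [Ideal.jacobson, Ideal.mem_sInf] at hj
  push Not at hj
  obtain ⟨M, ⟨hQM, hM⟩, hbM⟩ := hj
  obtain ⟨f, rfl⟩ := (isMaximal_iff_eq_vanishingIdeal_singleton (K := ℂ)).1 hM
  refine ⟨f, fun β => ?_, by simpa using hbM⟩
  have := hQM (hQ' (X β - C (y β)) (by simp))
  simpa [ψ, sub_eq_zero] using this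

/-! ### First-order calculus of polynomial functions -/

section Differential

variable {ι L : Type} [Fintype ι] [CommRing L] [Algebra ℂ L]

/-- The differential at `y`, in the direction `w`, of the polynomial function `p`. -/
def polyDiff (y w : ι → L) (p : MvPolynomial ι ℂ) : L := ∑ β, aeval y (pderiv β p) * w β

theorem polyDiff_add (y w : ι → L) (p q : MvPolynomial ι ℂ) :
    polyDiff y w (p + q) = polyDiff y w p + polyDiff y w q := by
  simp [polyDiff, add_mul, Finset.sum_add_distrib]

theorem polyDiff_C (y w : ι → L) (z : ℂ) : polyDiff y w (C z) = 0 := by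
  simp [polyDiff]

theorem polyDiff_X (y w : ι → L) (β : ι) : polyDiff y w (X β) = w β := by
  classical
  simp [polyDiff, pderiv_X, Pi.single_apply, apply_ite, Finset.sum_ite_eq]

theorem polyDiff_mul (y w : ι → L) (p q : MvPolynomial ι ℂ) :
    polyDiff y w (p * q) = aeval y p * polyDiff y w q + aeval y q * polyDiff y w p := by
  simp only [polyDiff, Derivation.leibniz, smul_eq_mul, map_add, map_mul, add_mul,
    Finset.sum_add_distrib, Finset.mul_sum, mul_assoc]

theorem polyDiff_smul_right (y w : ι → L) (z : L) (p : MvPolynomial ι ℂ) :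
    polyDiff y (z • w) p = z * polyDiff y w p := by
  simp only [polyDiff, Pi.smul_apply, smul_eq_mul, Finset.mul_sum]
  exact Finset.sum_congr rfl fun _ _ => by ring

theorem aeval_dualNumber (y w : ι → L) (p : MvPolynomial ι ℂ) :
    aeval (fun β => (TrivSqZeroExt.inl (y β) + TrivSqZeroExt.inr (w β) : TrivSqZeroExt L L)) p =
      TrivSqZeroExt.inl (aeval y p) + TrivSqZeroExt.inr (polyDiff y w p) := by
  induction p using MvPolynomial.induction_on with
  | C z =>
    rw [polyDiff_C, aeval_C, aeval_C]
    simp [TrivSqZeroExt.algebraMap_eq_inl']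
  | add p q hp hq =>
    rw [map_add, hp, hq, polyDiff_add, map_add]
    ext <;> simp
  | mul_X p β hp =>
    rw [map_mul, hp, polyDiff_mul, polyDiff_X, aeval_X, map_mul, aeval_X]
    ext <;> simp [mul_comm, add_comm]

theorem derivation_aeval (D : Derivation ℂ L L) (y : ι → L) (p : MvPolynomial ι ℂ) :
    D (aeval y p) = polyDiff y (fun β => D (y β)) p := by
  induction p using MvPolynomial.induction_on with
  | C z => rw [polyDiff_C, aeval_C, D.map_algebraMap]
  | add p q hp hq => rw [map_add, map_add, hp, hq, polyDiff_add]
  | mul_X p β hp =>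
    rw [map_mul, D.leibniz, hp, polyDiff_mul, polyDiff_X, aeval_X]
    simp

variable {κ : Type}

/-- The Jacobian matrix of a family of polynomials. -/
def jacobianMatrix (g : κ → MvPolynomial ι ℂ) : Matrix κ ι (MvPolynomial ι ℂ) :=
  Matrix.of fun j β => pderiv β (g j)

/-- The Zariski tangent space at `y` to the common zeros of the polynomials `g j`. -/
def tangentSpace (g : κ → MvPolynomial ι ℂ) (y : ι → L) : Submodule L (ι → L) :=
  LinearMap.ker ((jacobianMatrix g).map (aeval y)).mulVecLin

theorem mem_tangentSpace {g : κ → MvPolynomial ι ℂ} {y w : ι → L} :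
    w ∈ tangentSpace g y ↔ ∀ j, polyDiff y w (g j) = 0 := by
  rw [tangentSpace, LinearMap.mem_ker, funext_iff]
  rfl

/-- The Leibniz rule carries the vanishing of the value and of the differential together from
generators to the ideal. -/
theorem polyDiff_eq_zero_of_mem_span {g : κ → MvPolynomial ι ℂ} {y w : ι → L}
    (hy : ∀ j, aeval y (g j) = 0) (hw : w ∈ tangentSpace g y) {p : MvPolynomial ι ℂ}
    (hp : p ∈ Ideal.span (Set.range g)) :
    aeval y p = 0 ∧ polyDiff y w p = 0 := by
  rw [mem_tangentSpace] at hw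
  induction hp using Submodule.span_induction with
  | mem q hq =>
    obtain ⟨j, rfl⟩ := hq
    exact ⟨hy j, hw j⟩
  | zero => simp [polyDiff]
  | add p q _ _ hp hq =>
    rw [map_add, polyDiff_add, hp.1, hp.2, hq.1, hq.2]
    simp
  | smul a p _ hp =>
    rw [smul_eq_mul, map_mul, polyDiff_mul, hp.1, hp.2]
    simp

end Differential

/-! ### Tangent spaces and transcendence degree -/

section Tangent

variable {ι κ K : Type} [Fintype ι] [Field K] [Algebra ℂ K]

/-- The hypothesis on the ideal makes `y` a generic point of the zero locus of `g`. A tangent vector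
there is a ring map from ℂ[y] to the dual numbers over `K`, which extends to a derivation of `K`. -/
theorem exists_derivation_of_mem_tangentSpace [Algebra.EssFiniteType ℂ K] {y w : ι → K}
    {g : κ → MvPolynomial ι ℂ} (hg : Ideal.span (Set.range g) = RingHom.ker (aeval (R := ℂ) y))
    (hw : w ∈ tangentSpace g y) : ∃ D : Derivation ℂ K K, ∀ β, D (y β) = w β := by
  have hy : ∀ j, aeval y (g j) = 0 := fun j => by
    have : g j ∈ Ideal.span (Set.range g) := Ideal.subset_span ⟨j, rfl⟩
    rwa [hg] at this
  let P := RingHom.ker (aeval (R := ℂ) y)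
  have hP : P.IsPrime := RingHom.ker_isPrime _
  let e := aeval (R := ℂ)
    (fun β => (TrivSqZeroExt.inl (y β) + TrivSqZeroExt.inr (w β) : TrivSqZeroExt K K))
  have he : ∀ p ∈ P, e p = 0 := fun p hp => by
    obtain ⟨h1, h2⟩ := polyDiff_eq_zero_of_mem_span hy hw (by rw [hg]; exact hp)
    rw [aeval_dualNumber, h1, h2]
    simp
  obtain ⟨D, hD⟩ := exists_derivation_extending (A := MvPolynomial ι ℂ ⧸ P)
    (Ideal.kerLiftAlg (aeval (R := ℂ) y)) (Ideal.kerLiftAlg_injective _)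
    (Ideal.Quotient.liftₐ P e he) (fun a => by
      obtain ⟨p, rfl⟩ := Ideal.Quotient.mk_surjective a
      change (e p).fst = aeval y p
      rw [aeval_dualNumber]
      simp)
  refine ⟨D, fun β => ?_⟩
  have := hD (Ideal.Quotient.mk P (X β))
  change D (aeval y (X β)) = (e (X β)).snd at this
  rw [aeval_dualNumber, polyDiff_X, aeval_X] at this
  simpa using this

/-- A derivation in characteristic zero vanishes on the roots of polynomials with constant
coefficients. -/
theorem derivation_eq_zero_of_eval_eq_zero (D : Derivation ℂ K K) {x : K} (p : Polynomial K)
    (hp : p ≠ 0) (hc : ∀ n, D (p.coeff n) = 0) (hx : p.eval x = 0) : D x = 0 := by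
  have : CharZero K := charZero_of_injective_algebraMap (algebraMap ℂ K).injective
  induction hn : p.natDegree using Nat.strong_induction_on generalizing p with
  | _ n ih =>
    have h0 : D.mapCoeffs p = 0 := PolynomialModule.ext (Finsupp.ext hc)
    have h1 := D.apply_eval_eq x p
    rw [hx, h0, map_zero, map_zero, zero_add] at h1
    -- Differentiating p(x) = 0 gives p′(x) D x = 0. If p′(x) = 0, then p′ is a nonzero polynomial
    -- of smaller degree with root x, and induction applies.
    by_cases h2 : p.derivative.eval x = 0
    · have h3 : p.natDegree ≠ 0 := fun h => by
        rw [Polynomial.eq_C_of_natDegree_eq_zero h, Polynomial.eval_C] at hx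
        exact hp (by rw [Polynomial.eq_C_of_natDegree_eq_zero h, hx, Polynomial.C_0])
      refine ih _ ?_ p.derivative (fun h => h3 (Polynomial.derivative_eq_zero.1 h))
        (fun n => ?_) h2 rfl
      · rw [← hn]
        exact Polynomial.natDegree_derivative_lt h3
      · rw [Polynomial.coeff_derivative, D.leibniz, hc]
        simp
    · exact (smul_eq_zero.1 h1.symm).resolve_left h2

/-- Restricting tangent vectors to coordinates that form a transcendence basis is an isomorphism. It
is injective because a derivation that vanishes on the basis vanishes on everything algebraic over
it, and surjective because derivations of the polynomial ring on the basis take arbitrary values and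
extend to `K`. -/
theorem trdeg_adjoin_eq_finrank_tangentSpace [Algebra.EssFiniteType ℂ K] (y : ι → K)
    {g : κ → MvPolynomial ι ℂ} (hg : Ideal.span (Set.range g) = RingHom.ker (aeval (R := ℂ) y)) :
    Algebra.trdeg ℂ (Algebra.adjoin ℂ (Set.range y)) =
      (Module.finrank K (tangentSpace g y) : Cardinal) := by
  have hy : ∀ j, aeval y (g j) = 0 := fun j => by
    have : g j ∈ Ideal.span (Set.range g) := Ideal.subset_span ⟨j, rfl⟩
    rwa [hg] at this
  let B := Algebra.adjoin ℂ (Set.range y)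
  let yB : ι → B := fun β => ⟨y β, Algebra.subset_adjoin ⟨β, rfl⟩⟩
  have htop : Algebra.adjoin ℂ (Set.range yB) = ⊤ := by
    have : Set.range yB = (Subtype.val : B → K) ⁻¹' Set.range y := by
      ext b
      simp [yB, Subtype.ext_iff]
    rw [this]
    exact Algebra.adjoin_adjoin_coe_preimage
  have : Algebra.IsAlgebraic (Algebra.adjoin ℂ (Set.range yB)) B := by
    rw [htop]
    exact ⟨fun b => isAlgebraic_algebraMap (⟨b, trivial⟩ : (⊤ : Subalgebra ℂ B))⟩
  have : FaithfulSMul ℂ B := (faithfulSMul_iff_algebraMap_injective ℂ B).2 (algebraMap ℂ B).injective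
  obtain ⟨t, hts, ht⟩ := exists_isTranscendenceBasis_subset (R := ℂ) (Set.range yB)
  have hfin : Finite t := (Set.finite_range yB).subset hts
  have := Fintype.ofFinite t
  choose σ hσ using fun s : t => hts s.2
  have halg := ht.isAlgebraic
  let Λ : tangentSpace g y →ₗ[K] (t → K) :=
    (LinearMap.funLeft K K σ).comp (tangentSpace g y).subtype
  have hinj : Function.Injective Λ := by
    rw [← LinearMap.ker_eq_bot, LinearMap.ker_eq_bot']
    rintro ⟨w, hw⟩ h0
    obtain ⟨D, hD⟩ := exists_derivation_of_mem_tangentSpace hg hw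
    have h0' : ∀ s, w (σ s) = 0 := fun s => congrFun h0 s
    have hDt : ∀ b ∈ Algebra.adjoin ℂ (Set.range (Subtype.val : t → B)), D (b : K) = 0 := by
      intro b hb
      induction hb using Algebra.adjoin_induction with
      | mem b hb =>
        obtain ⟨s, rfl⟩ := hb
        rw [← hσ s]
        exact (hD _).trans (h0' s)
      | algebraMap z => exact D.map_algebraMap z
      | add a b _ _ ha hb =>
        rw [Subalgebra.coe_add, map_add, ha, hb, add_zero]
      | mul a b _ _ ha hb =>
        rw [Subalgebra.coe_mul, D.leibniz, ha, hb, smul_zero, smul_zero, add_zero]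
    ext β
    change w β = 0
    rw [← hD β]
    obtain ⟨p, hp, hpx⟩ := halg.isAlgebraic (yB β)
    let i : Algebra.adjoin ℂ (Set.range (Subtype.val : t → B)) →+* K :=
      (algebraMap B K).comp (algebraMap _ B)
    have hi : Function.Injective i := Subtype.val_injective.comp Subtype.val_injective
    refine derivation_eq_zero_of_eval_eq_zero D (p.map i) ((Polynomial.map_ne_zero_iff hi).2 hp)
      (fun n => ?_) ?_
    · rw [Polynomial.coeff_map]
      exact hDt _ (p.coeff n).2
    · have := congrArg (algebraMap B K) hpx
      rw [Polynomial.aeval_def, Polynomial.hom_eval₂, map_zero] at this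
      rw [Polynomial.eval_map]
      exact this
  have hsurj : Function.Surjective Λ := by
    intro z
    let φ : MvPolynomial t ℂ →ₐ[ℂ] K := aeval fun s => ((s : B) : K)
    have hφ : Function.Injective φ := by
      have := ht.1.map' (f := B.val) Subtype.val_injective
      exact this
    obtain ⟨D, hD⟩ := exists_derivation_extending φ hφ (aeval (R := ℂ)
      (fun s => (TrivSqZeroExt.inl ((s : B) : K) + TrivSqZeroExt.inr (z s) : TrivSqZeroExt K K)))
      (fun a => by rw [aeval_dualNumber]; simp [φ])
    refine ⟨⟨fun β => D (y β), mem_tangentSpace.2 fun j => ?_⟩, funext fun s => ?_⟩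
    · rw [← derivation_aeval, hy, map_zero]
    · have := hD (X s)
      rw [aeval_dualNumber, polyDiff_X, aeval_X] at this
      change D (y (σ s)) = z s
      have e : y (σ s) = ((s : B) : K) := congrArg Subtype.val (hσ s)
      rw [e]
      rw [this]
      simp
  rw [(LinearEquiv.ofBijective Λ ⟨hinj, hsurj⟩).finrank_eq, Module.finrank_pi,
    ← ht.cardinalMk_eq_trdeg, Cardinal.mk_fintype]

end Tangent

/-! ### Symmetric bilinear maps in coordinates -/

section Bilinear

variable {A ι : Type} [Fintype A] (c : A → A → ι → ℂ)

section Ring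

variable {L : Type} [CommRing L] [Algebra ℂ L]

/-- The bilinear map with structure constants `c`. -/
def bilin : (A → L) →ₗ[L] (A → L) →ₗ[L] (ι → L) :=
  LinearMap.mk₂ L (fun u v β => ∑ a, ∑ b, algebraMap ℂ L (c a b β) * (u a * v b))
    (fun u u' v => by
      ext β
      simp only [Pi.add_apply, add_mul, mul_add, Finset.sum_add_distrib])
    (fun z u v => by
      ext β
      simp only [Pi.smul_apply, smul_eq_mul, Finset.mul_sum]
      exact Finset.sum_congr rfl fun _ _ => Finset.sum_congr rfl fun _ _ => by ring)
    (fun u v v' => by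
      ext β
      simp only [Pi.add_apply, mul_add, Finset.sum_add_distrib])
    (fun z u v => by
      ext β
      simp only [Pi.smul_apply, smul_eq_mul, Finset.mul_sum]
      exact Finset.sum_congr rfl fun _ _ => Finset.sum_congr rfl fun _ _ => by ring)

theorem bilin_apply (u v : A → L) (β : ι) :
    bilin c u v β = ∑ a, ∑ b, algebraMap ℂ L (c a b β) * (u a * v b) := rfl

theorem bilin_comm (hc : ∀ a b, c a b = c b a) (u v : A → L) : bilin c u v = bilin c v u := by
  ext β
  rw [bilin_apply, bilin_apply, Finset.sum_comm]
  refine Finset.sum_congr rfl fun a _ => Finset.sum_congr rfl fun b _ => ?_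
  rw [hc b a]
  ring

theorem map_bilin {L' : Type} [CommRing L'] [Algebra ℂ L'] (e : L →ₐ[ℂ] L') (u v : A → L) (β : ι) :
    e (bilin c u v β) = bilin c (fun a => e (u a)) (fun a => e (v a)) β := by
  simp [bilin_apply]

theorem derivation_bilin (D : Derivation ℂ L L) (u v : A → L) (β : ι) :
    D (bilin c u v β) = bilin c u (fun a => D (v a)) β + bilin c (fun a => D (u a)) v β := by
  simp only [bilin_apply, map_sum, D.leibniz, D.map_algebraMap, smul_eq_mul, mul_zero, add_zero,
    ← Finset.sum_add_distrib]
  exact Finset.sum_congr rfl fun _ _ => Finset.sum_congr rfl fun _ _ => by ring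

theorem bilin_dualNumber (u u' v v' : A → L) (β : ι) :
    bilin c (fun a => (TrivSqZeroExt.inl (u a) + TrivSqZeroExt.inr (u' a) : TrivSqZeroExt L L))
      (fun a => TrivSqZeroExt.inl (v a) + TrivSqZeroExt.inr (v' a)) β =
      TrivSqZeroExt.inl (bilin c u v β) +
        TrivSqZeroExt.inr (bilin c u v' β + bilin c u' v β) := by
  simp only [bilin_apply, TrivSqZeroExt.algebraMap_eq_inl']
  ext
  · simp [TrivSqZeroExt.fst_sum]
  · simp only [TrivSqZeroExt.snd_sum, TrivSqZeroExt.snd_add, TrivSqZeroExt.snd_inl,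
      TrivSqZeroExt.snd_inr, TrivSqZeroExt.snd_mul, TrivSqZeroExt.fst_mul, TrivSqZeroExt.fst_add,
      TrivSqZeroExt.fst_inl, TrivSqZeroExt.fst_inr, ← Finset.sum_add_distrib]
    simp only [smul_eq_mul, MulOpposite.smul_eq_mul_unop, MulOpposite.unop_op, add_zero, zero_add,
      smul_zero, mul_add]

theorem bilin_single [DecidableEq A] (a b : A) (β : ι) :
    bilin c (Pi.single a (1 : L)) (Pi.single b 1) β = algebraMap ℂ L (c a b β) := by
  rw [bilin_apply, Finset.sum_eq_single a, Finset.sum_eq_single b]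
  · simp
  · intro b' _ h
    simp [h]
  · simp
  · intro a' _ h
    simp [h]
  · simp

variable {r : ℕ}

/-- The sum of the squares `f i * f i`. -/
def sqSum (f : Fin r → A → L) : ι → L := ∑ i, bilin c (f i) (f i)

/-- Half the differential of `sqSum` at `f`. -/
def sqDiff (f : Fin r → A → L) : (Fin r → A → L) →ₗ[L] (ι → L) :=
  ∑ i, (bilin c (f i)).comp (LinearMap.proj i)

theorem sqDiff_apply (f v : Fin r → A → L) : sqDiff c f v = ∑ i, bilin c (f i) (v i) := by
  simp [sqDiff]

theorem sqDiff_apply_apply (f v : Fin r → A → L) (β : ι) :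
    sqDiff c f v β = ∑ i, bilin c (f i) (v i) β := by
  simp [sqDiff]

theorem bilin_mem_range_sqDiff (f : Fin r → A → L) (i : Fin r) (v : A → L) :
    bilin c (f i) v ∈ LinearMap.range (sqDiff c f) := by
  classical
  refine ⟨Pi.single i v, ?_⟩
  rw [sqDiff_apply, Finset.sum_eq_single i]
  · simp
  · intro j _ h
    simp [h]
  · simp

theorem map_sqSum {L' : Type} [CommRing L'] [Algebra ℂ L'] (e : L →ₐ[ℂ] L') (f : Fin r → A → L)
    (β : ι) : e (sqSum c f β) = sqSum c (fun i a => e (f i a)) β := by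
  simp [sqSum, map_bilin]

theorem derivation_sqSum (hc : ∀ a b, c a b = c b a) (D : Derivation ℂ L L) (f : Fin r → A → L)
    (β : ι) : D (sqSum c f β) = 2 * sqDiff c f (fun i a => D (f i a)) β := by
  rw [sqSum, Finset.sum_apply, map_sum, sqDiff_apply_apply, Finset.mul_sum]
  refine Finset.sum_congr rfl fun i _ => ?_
  rw [derivation_bilin, bilin_comm c hc _ (f i)]
  ring

theorem sqSum_dualNumber (hc : ∀ a b, c a b = c b a) (f v : Fin r → A → L) (β : ι) :
    sqSum c (fun i a =>
      (TrivSqZeroExt.inl (f i a) + TrivSqZeroExt.inr (v i a) : TrivSqZeroExt L L)) β =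
      TrivSqZeroExt.inl (sqSum c f β) + TrivSqZeroExt.inr (((2 : L) • sqDiff c f v) β) := by
  rw [sqSum, Finset.sum_apply]
  simp only [bilin_dualNumber]
  rw [Finset.sum_add_distrib, ← TrivSqZeroExt.inl_sum, ← TrivSqZeroExt.inr_sum, Pi.smul_apply,
    sqDiff_apply_apply, sqSum, Finset.sum_apply, smul_eq_mul, Finset.mul_sum]
  congr 2
  refine Finset.sum_congr rfl fun i _ => ?_
  rw [bilin_comm c hc (v i)]
  ring

end Ring

/-! ### The generic tuple -/

variable (r : ℕ)

/-- The generic `r`-tuple of vectors. -/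
def genericTuple : Fin r → A → MvPolynomial (Fin r × A) ℂ := fun i a => X (i, a)

variable {r} {κ : Type} {g : κ → MvPolynomial ι ℂ}

theorem aeval_sqSum_genericTuple {L : Type} [CommRing L] [Algebra ℂ L] (f : Fin r → A → L) (β : ι) :
    aeval (fun x : Fin r × A => f x.1 x.2) (sqSum c (genericTuple r) β) = sqSum c f β := by
  rw [map_sqSum]
  simp [genericTuple]

/-- Every tuple over a ℂ-algebra, dual numbers included, is a specialization of the generic tuple.
-/
theorem aeval_sqSum_eq_zero {L : Type} [CommRing L] [Algebra ℂ L] (f : Fin r → A → L)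
    {p : MvPolynomial ι ℂ} (hp : aeval (sqSum c (genericTuple r (A := A))) p = 0) :
    aeval (sqSum c f) p = 0 := by
  have h := congrArg (aeval (R := ℂ) (fun x : Fin r × A => f x.1 x.2)) hp
  rw [map_zero, ← AlgHom.comp_apply, comp_aeval] at h
  rw [← h]
  congr 2
  funext β
  exact (aeval_sqSum_genericTuple c f β).symm

theorem aeval_generator_eq_zero
    (hg : Ideal.span (Set.range g) =
      RingHom.ker (aeval (R := ℂ) (sqSum c (genericTuple r (A := A)))))
    {L : Type} [CommRing L] [Algebra ℂ L] (f : Fin r → A → L) (j : κ) :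
    aeval (sqSum c f) (g j) = 0 := by
  apply aeval_sqSum_eq_zero
  have : g j ∈ Ideal.span (Set.range g) := Ideal.subset_span ⟨j, rfl⟩
  rwa [hg] at this

/-- The generators vanish at the sum of squares of f + εv over the dual numbers; the coefficient of
ε is twice the required identity. No genericity of `f` enters, so this applies to arbitrary
decompositions. -/
theorem range_sqDiff_le_tangentSpace [Fintype ι] (hc : ∀ a b, c a b = c b a)
    (hg : Ideal.span (Set.range g) =
      RingHom.ker (aeval (R := ℂ) (sqSum c (genericTuple r (A := A)))))
    {L : Type} [Field L] [Algebra ℂ L] (f : Fin r → A → L) :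
    LinearMap.range (sqDiff c f) ≤ tangentSpace g (sqSum c f) := by
  rintro _ ⟨v, rfl⟩
  have : CharZero L := charZero_of_injective_algebraMap (algebraMap ℂ L).injective
  rw [mem_tangentSpace]
  intro j
  have h := aeval_generator_eq_zero c hg (fun i a =>
      (TrivSqZeroExt.inl (f i a) + TrivSqZeroExt.inr (v i a) : TrivSqZeroExt L L)) j
  rw [funext (sqSum_dualNumber c hc f v), aeval_dualNumber] at h
  have h2 := congrArg TrivSqZeroExt.snd h
  rw [TrivSqZeroExt.snd_add, TrivSqZeroExt.snd_inl, TrivSqZeroExt.snd_inr, zero_add,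
    TrivSqZeroExt.snd_zero, polyDiff_smul_right] at h2
  simpa using h2

end Bilinear

/-! ### Open conditions on tuples and on points of the image closure -/

section Generic

variable {A ι : Type} [Fintype A] (c : A → A → ι → ℂ)

theorem ker_mulVecLin_specialization {m n R₀ L : Type} [Fintype m] [Fintype n] [CommRing R₀]
    [Field L] (G : Matrix m n R₀) (e : R₀ →+* L) (k : ℕ)
    (hk : Module.finrank L (LinearMap.ker (G.map e).mulVecLin) ≤ k) :
    ∃ a : R₀, e a ≠ 0 ∧ ∀ (L' : Type) [Field L'] (e' : R₀ →+* L'), e' a ≠ 0 →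
      Module.finrank L' (LinearMap.ker (G.map e').mulVecLin) ≤ k := by
  obtain ⟨a, ha, h⟩ := rank_specialization G e
  refine ⟨a, ha, fun L' _ e' h' => ?_⟩
  have h1 := h L' e' h'
  have h2 := finrank_ker_mulVecLin_add_rank (G.map e)
  have h3 := finrank_ker_mulVecLin_add_rank (G.map e')
  omega

/-! ### The space of vectors whose multiples are tangent -/

section TangentKernel

variable [Fintype ι] {κ : Type} {L : Type} [CommRing L] [Algebra ℂ L]

/-- The vectors all of whose multiples lie in the tangent space at `y`. -/
def tangentKernel (g : κ → MvPolynomial ι ℂ) (y : ι → L) : Submodule L (A → L) :=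
  ⨅ v : A → L, (tangentSpace g y).comap ((bilin c).flip v)

theorem mem_tangentKernel {g : κ → MvPolynomial ι ℂ} {y : ι → L} {u : A → L} :
    u ∈ tangentKernel c g y ↔ ∀ v, bilin c u v ∈ tangentSpace g y := by
  simp [tangentKernel, Submodule.mem_iInf]

theorem mem_tangentKernel_iff_single [DecidableEq A] {g : κ → MvPolynomial ι ℂ} {y : ι → L}
    {u : A → L} :
    u ∈ tangentKernel c g y ↔ ∀ b, bilin c u (Pi.single b 1) ∈ tangentSpace g y := by
  rw [mem_tangentKernel]
  refine ⟨fun h b => h _, fun h v => ?_⟩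
  rw [pi_eq_sum_univ' v, map_sum]
  refine Submodule.sum_mem _ fun b _ => ?_
  rw [map_smul]
  exact Submodule.smul_mem _ _ (h b)

/-- The matrix whose kernel is `tangentKernel`. -/
def tangentKernelMatrix (g : κ → MvPolynomial ι ℂ) : Matrix (κ × A) A (MvPolynomial ι ℂ) :=
  Matrix.of fun jb a => ∑ β, pderiv β (g jb.1) * C (c a jb.2 β)

theorem tangentKernel_eq_ker (g : κ → MvPolynomial ι ℂ) (y : ι → L) :
    tangentKernel c g y = LinearMap.ker ((tangentKernelMatrix c g).map (aeval y)).mulVecLin := by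
  classical
  ext u
  rw [mem_tangentKernel_iff_single, LinearMap.mem_ker, funext_iff, Prod.forall, forall_comm]
  refine forall_congr' fun b => ?_
  rw [mem_tangentSpace]
  refine forall_congr' fun j => ?_
  have : ∀ β, bilin c u (Pi.single b 1) β = ∑ a, algebraMap ℂ L (c a b β) * u a := fun β => by
    rw [bilin_apply]
    refine Finset.sum_congr rfl fun a _ => ?_
    rw [Finset.sum_eq_single b]
    · simp
    · intro b' _ h
      simp [h]
    · simp
  simp only [polyDiff, this, Matrix.mulVecLin_apply, Matrix.mulVec, dotProduct, Matrix.map_apply,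
    tangentKernelMatrix, Matrix.of_apply, map_sum, map_mul, aeval_C, Finset.mul_sum,
    Finset.sum_mul, Pi.zero_apply]
  rw [Finset.sum_comm]
  simp only [mul_assoc]

/-- Upper semicontinuity of kernel dimension: a bound at one complex point spreads to an open set of
points over every extension field, in particular to the generic point. -/
theorem exists_finrank_tangentKernel_le [Fintype κ] (g : κ → MvPolynomial ι ℂ) (y : ι → ℂ) {k : ℕ}
    (hk : Module.finrank ℂ (tangentKernel c g y) ≤ k) :
    ∃ a : MvPolynomial ι ℂ, aeval y a ≠ 0 ∧ ∀ (L : Type) [Field L] [Algebra ℂ L] (y' : ι → L),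
      aeval y' a ≠ 0 → Module.finrank L (tangentKernel c g y') ≤ k := by
  rw [tangentKernel_eq_ker] at hk
  obtain ⟨a, ha, h⟩ := ker_mulVecLin_specialization (tangentKernelMatrix c g)
    (aeval (R := ℂ) y).toRingHom k hk
  refine ⟨a, ha, fun L _ _ y' hy' => ?_⟩
  rw [tangentKernel_eq_ker]
  exact h L (aeval (R := ℂ) y').toRingHom hy'

end TangentKernel

/-! ### Generic linear independence -/

variable (r : ℕ)

/-- The generic tuple over the field of rational functions. -/
def genericPoint : Fin r → A → FractionRing (MvPolynomial (Fin r × A) ℂ) :=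
  fun i a => algebraMap _ _ (genericTuple r i a)

variable {r}

theorem aeval_genericPoint {A : Type} (p : MvPolynomial (Fin r × A) ℂ) :
    aeval (fun x : Fin r × A => genericPoint r x.1 x.2) p =
      algebraMap _ (FractionRing (MvPolynomial (Fin r × A) ℂ)) p := by
  have := aeval_algebraMap_apply (R := ℂ) (FractionRing (MvPolynomial (Fin r × A) ℂ))
    (X : Fin r × A → MvPolynomial (Fin r × A) ℂ) p
  rw [aeval_X_left_apply] at this
  exact this

theorem exists_linearIndependent_of_le_card (h : r ≤ Fintype.card A) :
    ∃ b : MvPolynomial (Fin r × A) ℂ, b ≠ 0 ∧ ∀ (L : Type) [Field L] [Algebra ℂ L]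
      (f : Fin r → A → L), aeval (fun x : Fin r × A => f x.1 x.2) b ≠ 0 → LinearIndependent L f := by
  classical
  let G : Matrix A (Fin r) (MvPolynomial (Fin r × A) ℂ) := Matrix.of fun a i => X (i, a)
  have key : ∀ (L : Type) [Field L] [Algebra ℂ L] (f : Fin r → A → L), LinearIndependent L f ↔
      Module.finrank L (LinearMap.ker
        (G.map (aeval (R := ℂ) (fun x : Fin r × A => f x.1 x.2)).toRingHom).mulVecLin) ≤ 0 := by
    intro L _ _ f
    rw [Nat.le_zero, Submodule.finrank_eq_zero, LinearMap.ker_eq_bot,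
      Matrix.coe_mulVecLin, Matrix.mulVec_injective_iff]
    have : (G.map (aeval (R := ℂ) (fun x : Fin r × A => f x.1 x.2)).toRingHom).col = f := by
      funext i a
      simp [G]
    rw [this]
  -- Distinct coordinate vectors provide one independent tuple, so the minor obtained is a nonzero
  -- polynomial.
  obtain ⟨σ⟩ : Nonempty (Fin r ↪ A) :=
    Function.Embedding.nonempty_of_card_le (by simpa using h)
  have hli : LinearIndependent ℂ (fun i => (Pi.single (σ i) 1 : A → ℂ)) :=
    (Pi.linearIndependent_single_one A ℂ).comp σ σ.injective
  obtain ⟨b, hb, hb'⟩ := ker_mulVecLin_specialization G _ 0 ((key ℂ _).1 hli)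
  exact ⟨b, fun h0 => hb (by rw [h0, map_zero]), fun L _ _ f hf => (key L f).2 (hb' L _ hf)⟩

/-! ### Quadratic relations -/

section Quadratic

variable {L : Type} [CommRing L] [Algebra ℂ L]

/-- The vectors `f i` satisfy no nontrivial quadratic relation. -/
def QuadIndependent (f : Fin r → A → L) : Prop :=
  ∀ S : Matrix (Fin r) (Fin r) L, S.IsSymm → ∑ i, ∑ j, S i j • bilin c (f i) (f j) = 0 → S = 0

end Quadratic

theorem exists_quadIndependent [Fintype ι] (h : QuadIndependent c (genericPoint r)) :
    ∃ b : MvPolynomial (Fin r × A) ℂ, b ≠ 0 ∧ ∀ (L : Type) [Field L] [Algebra ℂ L]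
      (f : Fin r → A → L), aeval (fun x : Fin r × A => f x.1 x.2) b ≠ 0 → QuadIndependent c f := by
  classical
  -- The unknowns are the entries of `S`. Rows in `ι` express the quadratic relation, rows in `Fin r
  -- × Fin r` the symmetry of `S`.
  let G : Matrix (ι ⊕ Fin r × Fin r) (Fin r × Fin r) (MvPolynomial (Fin r × A) ℂ) :=
    Matrix.of fun s q => Sum.elim (fun β => bilin c (genericTuple r q.1) (genericTuple r q.2) β)
      (fun p => (if q = p then 1 else 0) - (if q = p.swap then 1 else 0)) s
  have key : ∀ (L : Type) [Field L] [Algebra ℂ L] (f : Fin r → A → L), QuadIndependent c f ↔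
      Module.finrank L (LinearMap.ker
        (G.map (aeval (R := ℂ) (fun x : Fin r × A => f x.1 x.2)).toRingHom).mulVecLin) ≤ 0 := by
    intro L _ _ f
    rw [Nat.le_zero, Submodule.finrank_eq_zero, LinearMap.ker_eq_bot']
    have h1 : ∀ z : Fin r × Fin r → L,
        (G.map (aeval (R := ℂ) (fun x : Fin r × A => f x.1 x.2)).toRingHom).mulVecLin z = 0 ↔
          (Matrix.of fun i j => z (i, j)).IsSymm ∧ ∑ i, ∑ j, z (i, j) • bilin c (f i) (f j) = 0 := by
      intro z
      rw [funext_iff, Sum.forall, and_comm]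
      refine and_congr ?_ ?_
      · rw [Prod.forall, Matrix.IsSymm.ext_iff, forall_comm]
        refine forall_congr' fun i => forall_congr' fun j => ?_
        simp [Matrix.mulVec, dotProduct, G, sub_mul, sub_eq_zero]
      · rw [funext_iff]
        refine forall_congr' fun β => ?_
        simp [Matrix.mulVec, dotProduct, G, Fintype.sum_prod_type, map_bilin, genericTuple,
          mul_comm]
    refine ⟨fun hf z hz => ?_, fun hf S hS hS' => ?_⟩
    · obtain ⟨h2, h3⟩ := (h1 z).1 hz
      have := hf _ h2 h3
      funext q
      exact congrFun (congrFun this q.1) q.2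
    · have := hf (fun q => S q.1 q.2) ((h1 _).2 ⟨hS, hS'⟩)
      ext i j
      exact congrFun this (i, j)
  obtain ⟨b, hb, hb'⟩ := ker_mulVecLin_specialization G _ 0 ((key _ _).1 h)
  exact ⟨b, fun h0 => hb (by rw [h0, map_zero]), fun L _ _ f hf => (key L f).2 (hb' L _ hf)⟩

end Generic

/-! ### Quadratic relations force a surjective differential -/

section GenericPoint

variable {A ι : Type} [Fintype A] (c : A → A → ι → ℂ) {r : ℕ}

theorem derivation_smul_apply {L : Type} [CommRing L] [Algebra ℂ L] (D : Derivation ℂ L L)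
    (z : L) (w : ι → L) :
    (fun β => D ((z • w) β)) = z • (fun β => D (w β)) + D z • w := by
  ext β
  simp [D.leibniz, mul_comm]

theorem derivation_bilin_fun {L : Type} [CommRing L] [Algebra ℂ L] (D : Derivation ℂ L L)
    (u v : A → L) : (fun β => D (bilin c u v β)) =
      bilin c u (fun a => D (v a)) + bilin c (fun a => D (u a)) v :=
  funext (derivation_bilin c D u v)

theorem derivation_sum_fun {L σ : Type} [CommRing L] [Algebra ℂ L] (D : Derivation ℂ L L)
    (s : Finset σ) (w : σ → ι → L) :
    (fun β => D ((∑ i ∈ s, w i) β)) = ∑ i ∈ s, fun β => D (w i β) := by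
  ext β
  simp

theorem pderiv_genericTuple {A : Type} [DecidableEq A] (k : Fin r) (b : A) (i : Fin r) :
    (fun a => pderiv (k, b) (genericTuple r i a)) =
      if i = k then Pi.single b (1 : MvPolynomial (Fin r × A) ℂ) else 0 := by
  ext1 a
  split_ifs with h
  · subst h
    by_cases hab : a = b
    · subst hab
      simp [genericTuple]
    · rw [genericTuple, pderiv_X_of_ne (by simpa using hab), Pi.single_eq_of_ne hab]
  · rw [genericTuple, pderiv_X_of_ne (by simp [h]), Pi.zero_apply]

/-- Differentiating a quadratic relation among the generic vectors twice. -/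
theorem smul_bilin_single_mem_range [DecidableEq A] (hc : ∀ a b, c a b = c b a)
    (S : Matrix (Fin r) (Fin r) (MvPolynomial (Fin r × A) ℂ)) (hS : S.IsSymm)
    (h : ∑ i, ∑ j, S i j • bilin c (genericTuple r i) (genericTuple r j) = 0) (k l : Fin r)
    (a b : A) :
    S l k • bilin c (Pi.single a 1) (Pi.single b 1) ∈
      LinearMap.range (sqDiff c (genericTuple r (A := A))) := by
  let I := LinearMap.range (sqDiff c (genericTuple r (A := A)))
  let x := genericTuple r (A := A)
  have hI : ∀ i v, bilin c (x i) v ∈ I := bilin_mem_range_sqDiff c x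
  have hI' : ∀ i v, bilin c v (x i) ∈ I := fun i v => by
    rw [bilin_comm c hc]
    exact hI i v
  let D := pderiv (R := ℂ) (k, b)
  let D' := pderiv (R := ℂ) (l, a)
  -- The derivative of the relation with respect to the coordinate `b` of the `k`-th vector; the
  -- factor 2 comes from the symmetry of `S`.
  have h1 : ∑ i, ∑ j, D (S i j) • bilin c (x i) (x j) +
      (2 : MvPolynomial (Fin r × A) ℂ) • ∑ i, S i k • bilin c (x i) (Pi.single b 1) = 0 := by
    have h2 : (fun β => D ((∑ i, ∑ j, S i j • bilin c (x i) (x j)) β)) = 0 := by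
      rw [h]
      ext1 β
      simp
    rw [← h2]
    simp only [derivation_sum_fun, derivation_smul_apply, derivation_bilin_fun, smul_add,
      Finset.sum_add_distrib]
    have e1 : ∑ i, ∑ j, S i j • bilin c (x i) (fun a => D (x j a)) =
        ∑ i, S i k • bilin c (x i) (Pi.single b 1) := by
      refine Finset.sum_congr rfl fun i _ => ?_
      rw [Finset.sum_eq_single k]
      · rw [pderiv_genericTuple, if_pos rfl]
      · intro j _ hj
        rw [pderiv_genericTuple, if_neg hj, map_zero, smul_zero]
      · simp
    have e2 : ∑ i, ∑ j, S i j • bilin c (fun a => D (x i a)) (x j) =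
        ∑ i, S i k • bilin c (x i) (Pi.single b 1) := by
      rw [Finset.sum_comm, ← e1]
      refine Finset.sum_congr rfl fun i _ => Finset.sum_congr rfl fun j _ => ?_
      rw [hS.apply, bilin_comm c hc]
    rw [e1, e2, two_smul]
    abel
  have h3 := congrArg (fun w : ι → MvPolynomial (Fin r × A) ℂ => fun β => D' (w β)) h1
  -- After the second derivative every term of the first sum still contains a generic vector, so it
  -- lies in `I`. Modulo `I` only the term of the second sum where `D'` hits the `l`-th vector
  -- survives.
  have h4 : (fun β => D' ((∑ i, ∑ j, D (S i j) • bilin c (x i) (x j)) β)) ∈ I := by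
    simp only [derivation_sum_fun, derivation_smul_apply, derivation_bilin_fun]
    refine Submodule.sum_mem _ fun i _ => Submodule.sum_mem _ fun j _ => ?_
    exact I.add_mem (I.smul_mem _ (I.add_mem (hI _ _) (hI' _ _))) (I.smul_mem _ (hI _ _))
  have h5 : (fun β => D' ((∑ i, S i k • bilin c (x i) (Pi.single b 1)) β)) =
      S l k • bilin c (Pi.single a 1) (Pi.single b 1) +
        ∑ i, D' (S i k) • bilin c (x i) (Pi.single b 1) := by
    simp only [derivation_sum_fun, derivation_smul_apply, derivation_bilin_fun, smul_add,
      Finset.sum_add_distrib]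
    have e0 : (fun a => D' ((Pi.single b 1 : A → MvPolynomial (Fin r × A) ℂ) a)) = 0 := by
      ext1 a
      by_cases hab : a = b
      · subst hab
        simp
      · simp [hab]
    have e1 : ∑ i, S i k • bilin c (fun a => D' (x i a)) (Pi.single b 1) =
        S l k • bilin c (Pi.single a 1) (Pi.single b 1) := by
      rw [Finset.sum_eq_single l]
      · rw [pderiv_genericTuple, if_pos rfl]
      · intro j _ hj
        rw [pderiv_genericTuple, if_neg hj, map_zero, LinearMap.zero_apply, smul_zero]
      · simp
    rw [e1, e0]
    simp
  have h6 : (fun β => D' ((∑ i, ∑ j, D (S i j) • bilin c (x i) (x j)) β)) +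
      (2 : MvPolynomial (Fin r × A) ℂ) •
        (fun β => D' ((∑ i, S i k • bilin c (x i) (Pi.single b 1)) β)) = 0 := by
    ext1 β
    have := congrFun h3 β
    simp only [Pi.add_apply, Pi.smul_apply, map_add, smul_eq_mul, D'.leibniz, Pi.zero_apply,
      map_zero] at this
    rw [show (2 : MvPolynomial (Fin r × A) ℂ) = C 2 from (map_ofNat C 2).symm] at this
    rw [show (2 : MvPolynomial (Fin r × A) ℂ) = C 2 from (map_ofNat C 2).symm]
    simp only [D', pderiv_C, mul_zero, add_zero] at this
    simpa using this
  have h7 : (2 : MvPolynomial (Fin r × A) ℂ) •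
      (fun β => D' ((∑ i, S i k • bilin c (x i) (Pi.single b 1)) β)) ∈ I := by
    rw [eq_neg_of_add_eq_zero_right h6]
    exact I.neg_mem h4
  have h8 := I.smul_mem (C (1 / 2)) h7
  rw [smul_smul, show (C (1 / 2) * 2 : MvPolynomial (Fin r × A) ℂ) = 1 by
    rw [show (2 : MvPolynomial (Fin r × A) ℂ) = C 2 from (map_ofNat C 2).symm, ← C_mul]
    norm_num, one_smul, h5] at h8
  exact (I.add_mem_iff_left (I.sum_mem fun i _ => I.smul_mem _ (hI i _))).1 h8

theorem map_mem_range_sqDiff {L : Type} [CommRing L] [Algebra ℂ L] (f : Fin r → A → L)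
    {w : ι → MvPolynomial (Fin r × A) ℂ}
    (hw : w ∈ LinearMap.range (sqDiff c (genericTuple r (A := A)))) :
    (fun β => aeval (fun x : Fin r × A => f x.1 x.2) (w β)) ∈ LinearMap.range (sqDiff c f) := by
  obtain ⟨v, rfl⟩ := hw
  refine ⟨fun i a => aeval (fun x : Fin r × A => f x.1 x.2) (v i a), ?_⟩
  ext β
  simp [sqDiff_apply, map_bilin, genericTuple]

/-- If generic vectors satisfy a quadratic relation, then the differential is generically
surjective. -/
theorem exists_range_eq_top (hc : ∀ a b, c a b = c b a)
    (hspan : Submodule.span ℂ (Set.range fun ab : A × A => c ab.1 ab.2) = ⊤)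
    (h : ¬ QuadIndependent c (genericPoint r)) :
    ∃ b : MvPolynomial (Fin r × A) ℂ, b ≠ 0 ∧ ∀ f : Fin r → A → ℂ,
      aeval (fun x : Fin r × A => f x.1 x.2) b ≠ 0 → LinearMap.range (sqDiff c f) = ⊤ := by
  classical
  rw [QuadIndependent] at h
  push Not at h
  obtain ⟨S, hS, hrel, hS0⟩ := h
  let R := MvPolynomial (Fin r × A) ℂ
  let K := FractionRing R
  -- Clearing denominators gives a relation with polynomial coefficients, which can be
  -- differentiated and specialized.
  obtain ⟨m, hm⟩ := IsLocalization.exist_integer_multiples_of_finite (nonZeroDivisors R)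
    (fun q : Fin r × Fin r => S q.1 q.2)
  choose T' hT' using hm
  let T : Matrix (Fin r) (Fin r) R := Matrix.of fun i j => T' (i, j)
  have hT : ∀ i j, algebraMap R K (T i j) = algebraMap R K m * S i j := fun i j => by
    rw [← Algebra.smul_def]
    exact hT' (i, j)
  have hm0 : algebraMap R K m ≠ 0 :=
    (map_ne_zero_iff _ (IsFractionRing.injective R K)).2 (nonZeroDivisors.ne_zero m.2)
  have hTs : T.IsSymm := by
    refine Matrix.ext fun i j => ?_
    apply IsFractionRing.injective R K
    rw [Matrix.transpose_apply, hT, hT, hS.apply]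
  have hTrel : ∑ i, ∑ j, T i j • bilin c (genericTuple r i) (genericTuple r j) = 0 := by
    ext1 β
    apply IsFractionRing.injective R K
    have h1 := congrFun hrel β
    have h2 : ∀ i j, algebraMap R K (bilin c (genericTuple r i) (genericTuple r j) β) =
        bilin c (genericPoint r i) (genericPoint r j) β := fun i j =>
      map_bilin c (Algebra.algHom ℂ R K) _ _ β
    simp only [Finset.sum_apply, Pi.smul_apply, smul_eq_mul, map_sum, map_mul, hT, h2,
      Pi.zero_apply, map_zero, mul_assoc] at h1 ⊢
    simp only [← Finset.mul_sum]
    rw [h1, mul_zero]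
  obtain ⟨l, k, hlk⟩ : ∃ l k, S l k ≠ 0 := by
    by_contra! h
    exact hS0 (Matrix.ext h)
  -- Where this nonzero entry does not vanish, it can be divided out, so all products of basis
  -- vectors lie in the image; they span.
  refine ⟨T l k, fun h0 => ?_, fun f hf => ?_⟩
  · have := hT l k
    rw [h0, map_zero] at this
    exact mul_ne_zero hm0 hlk this.symm
  · rw [eq_top_iff, ← hspan, Submodule.span_le]
    rintro _ ⟨⟨a, b⟩, rfl⟩
    have h1 := map_mem_range_sqDiff c f (smul_bilin_single_mem_range c hc T hTs hTrel k l a b)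
    have h2 := Submodule.smul_mem _ (aeval (fun x : Fin r × A => f x.1 x.2) (T l k))⁻¹ h1
    rw [SetLike.mem_coe]
    refine (congrArg (· ∈ LinearMap.range (sqDiff c f)) ?_).mpr h2
    ext β
    simp only [Pi.smul_apply, smul_eq_mul, map_mul, bilin_single]
    rw [inv_mul_cancel_left₀ hf, AlgHom.commutes]
    rfl

end GenericPoint

/-! ### The differential at the generic tuple -/

section GenericRank

variable {A ι : Type} [Fintype A] (c : A → A → ι → ℂ) {r : ℕ}

theorem map_sqSum_genericTuple (β : ι) :
    algebraMap _ (FractionRing (MvPolynomial (Fin r × A) ℂ)) (sqSum c (genericTuple r) β) =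
      sqSum c (genericPoint r) β :=
  map_sqSum c (Algebra.algHom ℂ (MvPolynomial (Fin r × A) ℂ) _) _ β

theorem aeval_sqSum_genericPoint (p : MvPolynomial ι ℂ) :
    aeval (sqSum c (genericPoint r (A := A))) p =
      algebraMap _ (FractionRing (MvPolynomial (Fin r × A) ℂ)) (aeval (sqSum c (genericTuple r)) p) := by
  rw [← aeval_algebraMap_apply]
  congr 2
  funext β
  exact (map_sqSum_genericTuple c β).symm

theorem ker_aeval_sqSum_genericPoint :
    RingHom.ker (aeval (R := ℂ) (sqSum c (genericPoint r (A := A)))) =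
      RingHom.ker (aeval (R := ℂ) (sqSum c (genericTuple r (A := A)))) := by
  ext p
  rw [RingHom.mem_ker, RingHom.mem_ker, aeval_sqSum_genericPoint]
  exact map_eq_zero_iff _ (IsFractionRing.injective _ _)

theorem two_ne_zero_of_algebra (K : Type) [Field K] [Algebra ℂ K] : (2 : K) ≠ 0 := by
  have : CharZero K := charZero_of_injective_algebraMap (algebraMap ℂ K).injective
  exact two_ne_zero

variable {κ : Type} {g : κ → MvPolynomial ι ℂ}

/-- A tangent vector `w` at the generic point comes from a derivation `D` of the function field with
D F = w, and the chain rule writes D F as twice `sqDiff` applied to the derivative of the tuple. -/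
theorem tangentSpace_genericPoint [Fintype ι] (hc : ∀ a b, c a b = c b a)
    (hg : Ideal.span (Set.range g) =
      RingHom.ker (aeval (R := ℂ) (sqSum c (genericTuple r (A := A))))) :
    tangentSpace g (sqSum c (genericPoint r (A := A))) =
      LinearMap.range (sqDiff c (genericPoint r (A := A))) := by
  refine le_antisymm (fun w hw => ?_) (range_sqDiff_le_tangentSpace c hc hg _)
  obtain ⟨D, hD⟩ := exists_derivation_of_mem_tangentSpace
    (hg.trans (ker_aeval_sqSum_genericPoint c).symm) hw
  refine ⟨(2 : FractionRing (MvPolynomial (Fin r × A) ℂ)) • fun i a => D (genericPoint r i a), ?_⟩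
  ext β
  rw [map_smul, Pi.smul_apply, smul_eq_mul, ← derivation_sqSum c hc, hD]

theorem exists_derivation_genericPoint
    (u : Fin r → A → FractionRing (MvPolynomial (Fin r × A) ℂ)) :
    ∃ D : Derivation ℂ (FractionRing (MvPolynomial (Fin r × A) ℂ))
      (FractionRing (MvPolynomial (Fin r × A) ℂ)), ∀ i a, D (genericPoint r i a) = u i a := by
  let K := FractionRing (MvPolynomial (Fin r × A) ℂ)
  obtain ⟨D, hD⟩ := exists_derivation_extending (Algebra.algHom ℂ (MvPolynomial (Fin r × A) ℂ) K)
    (IsFractionRing.injective _ _) (aeval fun x : Fin r × A =>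
      (TrivSqZeroExt.inl (genericPoint r x.1 x.2) + TrivSqZeroExt.inr (u x.1 x.2) :
        TrivSqZeroExt K K)) (fun p => by
      rw [aeval_dualNumber, aeval_genericPoint]
      simp only [TrivSqZeroExt.fst_add, TrivSqZeroExt.fst_inl, TrivSqZeroExt.fst_inr, add_zero]
      rfl)
  refine ⟨D, fun i a => (hD (X (i, a))).trans ?_⟩
  rw [aeval_X]
  simp

/-- Infinitesimal deformations of the generic tuple that fix the sum of squares consist of vectors
whose multiples are all tangent. -/
theorem mem_tangentKernel_of_sqDiff_eq_zero [Fintype ι] (hc : ∀ a b, c a b = c b a)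
    (hg : Ideal.span (Set.range g) =
      RingHom.ker (aeval (R := ℂ) (sqSum c (genericTuple r (A := A)))))
    {u : Fin r → A → FractionRing (MvPolynomial (Fin r × A) ℂ)}
    (hu : sqDiff c (genericPoint r) u = 0) (i : Fin r) :
    u i ∈ tangentKernel c g (sqSum c (genericPoint r (A := A))) := by
  classical
  rw [mem_tangentKernel_iff_single]
  intro b
  rw [mem_tangentSpace]
  intro j
  obtain ⟨D, hD⟩ := exists_derivation_genericPoint u
  have hDF : ∀ β, D (sqSum c (genericPoint r) β) = 0 := fun β => by
    rw [derivation_sqSum c hc]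
    simp only [hD]
    rw [hu, Pi.zero_apply, mul_zero]
  -- This equation says that x_i t_b is tangent at F. Differentiating it along `D`, the second
  -- derivatives of g_j drop out because D F = 0, and what remains says that u_i t_b is tangent.
  have h1 := mem_tangentSpace.1 (range_sqDiff_le_tangentSpace c hc hg (genericPoint r)
    (bilin_mem_range_sqDiff c (genericPoint r) i (Pi.single b 1))) j
  have h2 := congrArg D h1
  have e0 : (fun a => D ((Pi.single b 1 : A → FractionRing (MvPolynomial (Fin r × A) ℂ)) a)) = 0 := by
    ext1 a
    by_cases hab : a = b
    · subst hab
      simp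
    · simp [hab]
  rw [map_zero, polyDiff, map_sum] at h2
  rw [polyDiff, ← h2]
  refine Finset.sum_congr rfl fun β _ => ?_
  rw [D.leibniz, derivation_aeval, derivation_bilin, e0, funext hDF]
  simp [polyDiff, hD]

/-- Skew-symmetric `r × r` matrices. -/
def skewMatrices (K : Type) [Field K] (r : ℕ) : Submodule K (Matrix (Fin r) (Fin r) K) where
  carrier := {S | ∀ i j, S i j + S j i = 0}
  add_mem' {S T} hS hT i j := by
    have h1 := hS i j
    have h2 := hT i j
    simp only [Matrix.add_apply]
    linear_combination h1 + h2
  zero_mem' i j := by simp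
  smul_mem' z S hS i j := by
    have h1 := hS i j
    simp only [Matrix.smul_apply, smul_eq_mul]
    linear_combination z * h1

theorem finrank_skewMatrices (K : Type) [Field K] (h2 : (2 : K) ≠ 0) (r : ℕ) :
    Module.finrank K (skewMatrices K r) = r.choose 2 := by
  let Λ : skewMatrices K r →ₗ[K] ((j : Fin r) × Fin j → K) :=
    { toFun := fun S q => S.1 ⟨q.2, q.2.2.trans q.1.2⟩ q.1
      map_add' := fun S T => rfl
      map_smul' := fun z S => rfl }
  have hinj : Function.Injective Λ := by
    rw [← LinearMap.ker_eq_bot, LinearMap.ker_eq_bot']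
    rintro ⟨S, hS⟩ h0
    have hlt : ∀ i j : Fin r, i < j → S i j = 0 := fun i j hij => congrFun h0 ⟨j, ⟨i, hij⟩⟩
    ext i j
    change S i j = 0
    rcases lt_trichotomy i j with h | h | h
    · exact hlt i j h
    · subst h
      have := hS i i
      rw [← two_mul] at this
      exact (mul_eq_zero.1 this).resolve_left h2
    · have := hS i j
      rwa [hlt j i h, add_zero] at this
  have hsurj : Function.Surjective Λ := by
    intro z
    refine ⟨⟨Matrix.of fun i j => if h : i < j then z ⟨j, ⟨i, h⟩⟩ else
      if h : j < i then - z ⟨i, ⟨j, h⟩⟩ else 0, fun i j => ?_⟩, ?_⟩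
    · rcases lt_trichotomy i j with h | h | h
      · simp [h, h.not_gt]
      · simp [h]
      · simp [h, h.not_gt]
    · ext ⟨j, i⟩
      have : (⟨i, i.2.trans j.2⟩ : Fin r) < j := i.2
      exact dif_pos this
  rw [(LinearEquiv.ofBijective Λ ⟨hinj, hsurj⟩).finrank_eq, Module.finrank_pi]
  simp only [Fintype.card_sigma, Fintype.card_fin]
  rw [Fin.sum_univ_eq_sum_range (fun i => i) r, Finset.sum_range_id, Nat.choose_two_right]

/-- S ↦ Sx identifies skew matrices with the kernel. The components of a kernel element lie in the
tangent kernel, which by dimension is the span of x; the symmetrization of the coefficient matrix is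
then a quadratic relation, hence zero. -/
theorem finrank_ker_sqDiff_genericPoint [Fintype ι] (hc : ∀ a b, c a b = c b a)
    (hg : Ideal.span (Set.range g) =
      RingHom.ker (aeval (R := ℂ) (sqSum c (genericTuple r (A := A)))))
    (hq : QuadIndependent c (genericPoint r (A := A)))
    (hli : LinearIndependent (FractionRing (MvPolynomial (Fin r × A) ℂ))
      (genericPoint r (A := A)))
    (hK : Module.finrank (FractionRing (MvPolynomial (Fin r × A) ℂ))
      (tangentKernel c g (sqSum c (genericPoint r (A := A)))) ≤ r) :
    Module.finrank (FractionRing (MvPolynomial (Fin r × A) ℂ))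
      (LinearMap.ker (sqDiff c (genericPoint r (A := A)))) = r.choose 2 := by
  let K := FractionRing (MvPolynomial (Fin r × A) ℂ)
  let x := genericPoint r (A := A)
  have hspan : Submodule.span K (Set.range x) = tangentKernel c g (sqSum c x) := by
    apply Submodule.eq_of_le_of_finrank_le
    · rw [Submodule.span_le]
      rintro _ ⟨i, rfl⟩
      rw [SetLike.mem_coe, mem_tangentKernel]
      exact fun v => range_sqDiff_le_tangentSpace c hc hg _ (bilin_mem_range_sqDiff c x i v)
    · rwa [finrank_span_eq_card hli, Fintype.card_fin]
  have hcomb : ∀ S : Matrix (Fin r) (Fin r) K, sqDiff c x (fun i => ∑ j, S i j • x j) =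
      ∑ i, ∑ j, S i j • bilin c (x i) (x j) := fun S => by
    simp [sqDiff_apply]
  have hswap : ∀ S : Matrix (Fin r) (Fin r) K, ∑ i, ∑ j, S i j • bilin c (x i) (x j) =
      ∑ i, ∑ j, S j i • bilin c (x i) (x j) := fun S => by
    rw [Finset.sum_comm]
    refine Finset.sum_congr rfl fun i _ => Finset.sum_congr rfl fun j _ => ?_
    rw [bilin_comm c hc]
  let Λ : skewMatrices K r →ₗ[K] LinearMap.ker (sqDiff c x) :=
    { toFun := fun S => ⟨fun i => ∑ j, S.1 i j • x j, by
        rw [LinearMap.mem_ker, hcomb]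
        have h1 : ∑ i, ∑ j, S.1 i j • bilin c (x i) (x j) +
            ∑ i, ∑ j, S.1 i j • bilin c (x i) (x j) = 0 := by
          nth_rewrite 2 [hswap]
          simp only [← Finset.sum_add_distrib, ← add_smul]
          exact Finset.sum_eq_zero fun i _ => Finset.sum_eq_zero fun j _ => by
            rw [S.2 i j, zero_smul]
        rw [← two_smul K] at h1
        exact (smul_eq_zero.1 h1).resolve_left (two_ne_zero_of_algebra K)⟩
      map_add' := fun S T => by
        ext i a
        simp [add_mul, Finset.sum_add_distrib]
      map_smul' := fun z S => by
        ext i a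
        simp only [SetLike.val_smul, Matrix.smul_apply, Finset.sum_apply, Pi.smul_apply, smul_eq_mul,
          mul_assoc, RingHom.id_apply]
        exact (Finset.mul_sum _ _ _).symm }
  have hinj : Function.Injective Λ := by
    rw [← LinearMap.ker_eq_bot, LinearMap.ker_eq_bot']
    rintro ⟨S, hS⟩ h0
    have h1 : ∀ i, ∑ j, S i j • x j = 0 := fun i => congrFun (congrArg Subtype.val h0) i
    ext i j
    exact Fintype.linearIndependent_iff.1 hli (S i) (h1 i) j
  have hsurj : Function.Surjective Λ := by
    rintro ⟨u, hu⟩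
    have h1 : ∀ i, ∃ s : Fin r → K, ∑ j, s j • x j = u i := fun i => by
      have := mem_tangentKernel_of_sqDiff_eq_zero c hc hg hu i
      rw [← hspan] at this
      exact (Submodule.mem_span_range_iff_exists_fun K).1 this
    choose S hS using h1
    refine ⟨⟨Matrix.of S, fun i j => ?_⟩, Subtype.ext (funext hS)⟩
    have h2 : ∑ i, ∑ j, S i j • bilin c (x i) (x j) = 0 := by
      refine (hcomb (Matrix.of S)).symm.trans ?_
      exact (congrArg (sqDiff c x) (funext hS)).trans hu
    have h3 := hq (Matrix.of S + (Matrix.of S).transpose) (Matrix.isSymm_add_transpose_self _) (by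
      simp only [Matrix.add_apply, Matrix.transpose_apply, add_smul, Finset.sum_add_distrib]
      rw [← hswap]
      simp only [Matrix.of_apply]
      rw [h2, add_zero])
    exact congrFun (congrFun h3 i) j
  rw [← (LinearEquiv.ofBijective Λ ⟨hinj, hsurj⟩).finrank_eq,
    finrank_skewMatrices K (two_ne_zero_of_algebra K)]

/-- The matrix of `sqDiff` at the generic tuple. -/
def sqDiffMatrix (r : ℕ) : Matrix ι (Fin r × A) (MvPolynomial (Fin r × A) ℂ) :=
  Matrix.of fun β x => ∑ a, C (c a x.2 β) * X (x.1, a)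

theorem finrank_range_sqDiff [Fintype ι] {L : Type} [Field L] [Algebra ℂ L] (f : Fin r → A → L) :
    Module.finrank L (LinearMap.range (sqDiff c f)) = ((sqDiffMatrix c r).map
      (aeval (R := ℂ) (fun x : Fin r × A => f x.1 x.2)).toRingHom).rank := by
  have : ((sqDiffMatrix c r).map
      (aeval (R := ℂ) (fun x : Fin r × A => f x.1 x.2)).toRingHom).mulVecLin =
      (sqDiff c f).comp (LinearEquiv.curry L L (Fin r) A).toLinearMap := by
    ext1 v
    ext β
    simp [sqDiff_apply, Matrix.mulVec, dotProduct, Fintype.sum_prod_type, sqDiffMatrix, bilin_apply,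
      Finset.sum_mul, mul_assoc]
    refine Finset.sum_congr rfl fun i _ => ?_
    rw [Finset.sum_comm]
  rw [Matrix.rank, this, LinearMap.range_comp_of_range_eq_top _ (LinearEquiv.range _)]

/-- At a general tuple, the tangent space to the closure of the image is the image of the
differential. -/
theorem exists_tangentSpace_eq_range [Fintype ι] [Fintype κ] (hc : ∀ a b, c a b = c b a)
    (hg : Ideal.span (Set.range g) =
      RingHom.ker (aeval (R := ℂ) (sqSum c (genericTuple r (A := A))))) :
    ∃ b : MvPolynomial (Fin r × A) ℂ, b ≠ 0 ∧ ∀ f : Fin r → A → ℂ,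
      aeval (fun x : Fin r × A => f x.1 x.2) b ≠ 0 →
        tangentSpace g (sqSum c f) = LinearMap.range (sqDiff c f) := by
  -- `b₁` keeps the rank of the differential from dropping below its generic value, and `b₂` keeps
  -- the tangent space from growing above its own. The two generic values agree, so the inclusion is
  -- an equality.
  obtain ⟨b₁, hb₁, h₁⟩ := rank_specialization (sqDiffMatrix c r)
    (aeval (R := ℂ) (fun x : Fin r × A => genericPoint r x.1 x.2)).toRingHom
  obtain ⟨b₂, hb₂, h₂⟩ := ker_mulVecLin_specialization
    ((jacobianMatrix g).map (aeval (R := ℂ) (sqSum c (genericTuple r (A := A)))).toRingHom)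
    (aeval (R := ℂ) (fun x : Fin r × A => genericPoint r x.1 x.2)).toRingHom _ le_rfl
  have key : ∀ (L : Type) [Field L] [Algebra ℂ L] (f : Fin r → A → L), LinearMap.ker
      (((jacobianMatrix g).map (aeval (R := ℂ) (sqSum c (genericTuple r (A := A)))).toRingHom).map
        (aeval (R := ℂ) (fun x : Fin r × A => f x.1 x.2)).toRingHom).mulVecLin =
      tangentSpace g (sqSum c f) := by
    intro L _ _ f
    rw [tangentSpace, Matrix.map_map]
    congr 3
    funext p
    change aeval (R := ℂ) (fun x : Fin r × A => f x.1 x.2)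
      (aeval (sqSum c (genericTuple r (A := A))) p) = _
    rw [← AlgHom.comp_apply, comp_aeval]
    congr 2
    funext β
    exact aeval_sqSum_genericTuple c f β
  refine ⟨b₁ * b₂, mul_ne_zero (fun h => hb₁ (by rw [h, map_zero]))
    (fun h => hb₂ (by rw [h, map_zero])), fun f hf => ?_⟩
  rw [map_mul] at hf
  have h₁' := h₁ ℂ (aeval (R := ℂ) (fun x : Fin r × A => f x.1 x.2)).toRingHom
    (left_ne_zero_of_mul hf)
  have h₂' := h₂ ℂ (aeval (R := ℂ) (fun x : Fin r × A => f x.1 x.2)).toRingHom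
    (right_ne_zero_of_mul hf)
  rw [← finrank_range_sqDiff c (genericPoint r), ← finrank_range_sqDiff c f] at h₁'
  rw [key _ (genericPoint r), key _ f, tangentSpace_genericPoint c hc hg] at h₂'
  exact (Submodule.eq_of_le_of_finrank_le (range_sqDiff_le_tangentSpace c hc hg f)
    (h₂'.trans h₁')).symm

end GenericRank

/-! ### Uniqueness of decompositions up to O(r) -/

section Identifiability

variable {A ι : Type} [Fintype A] (c : A → A → ι → ℂ) {r : ℕ}

/-- Expanding the squares of the combinations turns the hypothesis into the symmetric quadratic
relation with matrix BᵀB − 1. -/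
theorem isOrthogonal_of_sqSum_eq {f : Fin r → A → ℂ}
    (hq : QuadIndependent c f) (B : Matrix (Fin r) (Fin r) ℂ)
    (h : sqSum c (fun i => ∑ j, B i j • f j) = sqSum c f) : B ∈ Matrix.orthogonalGroup (Fin r) ℂ := by
  have h1 : ∑ j, ∑ k, (B.transpose * B - 1) j k • bilin c (f j) (f k) = 0 := by
    have e1 : ∑ j, ∑ k, (B.transpose * B) j k • bilin c (f j) (f k) = sqSum c f := by
      have e3 : ∀ i, bilin c (∑ j, B i j • f j) (∑ k, B i k • f k) =
          ∑ j, ∑ k, (B i j * B i k) • bilin c (f j) (f k) := fun i => by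
        rw [LinearMap.map_sum₂]
        refine Finset.sum_congr rfl fun j _ => ?_
        rw [map_sum]
        refine Finset.sum_congr rfl fun k _ => ?_
        rw [map_smul, map_smul, LinearMap.smul_apply, smul_smul, mul_comm]
      rw [← h, sqSum]
      simp only [e3]
      simp only [Matrix.mul_apply, Finset.sum_smul]
      symm
      rw [Finset.sum_comm]
      refine Finset.sum_congr rfl fun j _ => ?_
      rw [Finset.sum_comm]
      rfl
    have e2 : ∑ j, ∑ k, (1 : Matrix (Fin r) (Fin r) ℂ) j k • bilin c (f j) (f k) = sqSum c f := by
      simp [sqSum, Matrix.one_apply, ite_smul]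
    simp only [Matrix.sub_apply, sub_smul, Finset.sum_sub_distrib]
    rw [e1, e2, sub_self]
  have h2 := hq _ (by
    rw [Matrix.IsSymm, Matrix.transpose_sub, Matrix.transpose_mul, Matrix.transpose_transpose,
      Matrix.transpose_one]) h1
  rw [Matrix.mem_orthogonalGroup_iff']
  exact sub_eq_zero.1 h2

/-- All decompositions of the same element lie in one tangent kernel, which depends only on that
element; independence of `f` and the bound `r` make it the span of `f`. -/
theorem sqSum_identifiable [Fintype ι] {κ : Type} {g : κ → MvPolynomial ι ℂ}
    (hc : ∀ a b, c a b = c b a)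
    (hg : Ideal.span (Set.range g) =
      RingHom.ker (aeval (R := ℂ) (sqSum c (genericTuple r (A := A)))))
    {f : Fin r → A → ℂ} (hli : LinearIndependent ℂ f) (hq : QuadIndependent c f)
    (hK : Module.finrank ℂ (tangentKernel c g (sqSum c f)) ≤ r) (h : Fin r → A → ℂ)
    (hh : sqSum c h = sqSum c f) :
    ∃ B ∈ Matrix.orthogonalGroup (Fin r) ℂ, ∀ i, h i = ∑ j, B i j • f j := by
  have hmem : ∀ h : Fin r → A → ℂ, sqSum c h = sqSum c f → ∀ i,
      h i ∈ tangentKernel c g (sqSum c f) := fun h hh i => by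
    rw [mem_tangentKernel, ← hh]
    exact fun v => range_sqDiff_le_tangentSpace c hc hg _ (bilin_mem_range_sqDiff c h i v)
  have hspan : Submodule.span ℂ (Set.range f) = tangentKernel c g (sqSum c f) := by
    apply Submodule.eq_of_le_of_finrank_le
    · rw [Submodule.span_le]
      rintro _ ⟨i, rfl⟩
      exact hmem f rfl i
    · rwa [finrank_span_eq_card hli, Fintype.card_fin]
  have h1 : ∀ i, ∃ s : Fin r → ℂ, ∑ j, s j • f j = h i := fun i => by
    have := hmem h hh i
    rw [← hspan] at this
    exact (Submodule.mem_span_range_iff_exists_fun ℂ).1 this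
  choose B hB using h1
  refine ⟨Matrix.of B, isOrthogonal_of_sqSum_eq c hq _ ?_, fun i => (hB i).symm⟩
  rw [← hh]
  exact congrArg (sqSum c) (funext hB)

/-- The main theorem for an arbitrary symmetric bilinear multiplication, in coordinates. -/
theorem exists_generic_identifiable [Fintype ι] (hc : ∀ a b, c a b = c b a)
    (hspan : Submodule.span ℂ (Set.range fun ab : A × A => c ab.1 ab.2) = ⊤)
    (hr : r ≤ Fintype.card A) :
    ∃ b : MvPolynomial (Fin r × A) ℂ, b ≠ 0 ∧ ∀ f₀ : Fin r → A → ℂ,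
      aeval (fun x : Fin r × A => f₀ x.1 x.2) b ≠ 0 → LinearMap.range (sqDiff c f₀) ≠ ⊤ →
      (∀ U : Submodule ℂ (A → ℂ), (∀ u ∈ U, ∀ v, bilin c u v ∈ LinearMap.range (sqDiff c f₀)) →
        Module.finrank ℂ U ≤ r) →
      Algebra.trdeg ℂ (Algebra.adjoin ℂ (Set.range (sqSum c (genericPoint r (A := A))))) =
        ((r * Fintype.card A - r.choose 2 : ℕ) : Cardinal) ∧
      ∃ a : MvPolynomial ι ℂ, aeval (sqSum c (genericTuple r (A := A))) a ≠ 0 ∧ ∀ y : ι → ℂ,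
        (∀ p : MvPolynomial ι ℂ, aeval (sqSum c (genericTuple r (A := A))) p = 0 → aeval y p = 0) →
        aeval y a ≠ 0 → ∃ f : Fin r → A → ℂ, sqSum c f = y ∧ LinearIndependent ℂ f ∧
          ∀ h : Fin r → A → ℂ, sqSum c h = y →
            ∃ B ∈ Matrix.orthogonalGroup (Fin r) ℂ, ∀ i, h i = ∑ j, B i j • f j := by
  let K := FractionRing (MvPolynomial (Fin r × A) ℂ)
  -- Hilbert's basis theorem makes the Jacobian matrix finite, as the rank arguments need.
  obtain ⟨k, g, hg⟩ := Submodule.fg_iff_exists_fin_generating_family.1 (IsNoetherian.noetherian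
    (RingHom.ker (aeval (R := ℂ) (sqSum c (genericTuple r (A := A))))))
  obtain ⟨b₁, hb₁, h₁⟩ := exists_tangentSpace_eq_range c hc hg
  obtain ⟨b₂, hb₂, h₂⟩ := exists_linearIndependent_of_le_card (A := A) hr
  by_cases hq : QuadIndependent c (genericPoint r (A := A))
  swap
  · obtain ⟨b, hb, h⟩ := exists_range_eq_top c hc hspan hq
    exact ⟨b, hb, fun f₀ hf₀ htop => absurd (h f₀ hf₀) htop⟩
  obtain ⟨b₃, hb₃, h₃⟩ := exists_quadIndependent c hq
  -- `f₀` serves only to bound one tangent kernel. Linear and quadratic independence are required of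
  -- another tuple, found below above a general `y`.
  refine ⟨b₁, hb₁, fun f₀ hf₀ _ hU => ?_⟩
  have hK₀ : Module.finrank ℂ (tangentKernel c g (sqSum c f₀)) ≤ r := by
    refine hU _ fun u hu v => ?_
    rw [← h₁ f₀ hf₀]
    exact (mem_tangentKernel c).1 hu v
  obtain ⟨a, ha, hak⟩ := exists_finrank_tangentKernel_le c g _ hK₀
  have haF : aeval (sqSum c (genericTuple r (A := A))) a ≠ 0 := fun h0 =>
    ha (aeval_sqSum_eq_zero c f₀ h0)
  have haK : aeval (sqSum c (genericPoint r (A := A))) a ≠ 0 := by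
    rw [aeval_sqSum_genericPoint]
    exact (map_ne_zero_iff _ (IsFractionRing.injective _ _)).2 haF
  have hliK : LinearIndependent K (genericPoint r (A := A)) := by
    apply h₂
    rw [aeval_genericPoint]
    exact (map_ne_zero_iff _ (IsFractionRing.injective _ _)).2 hb₂
  refine ⟨?_, ?_⟩
  · rw [trdeg_adjoin_eq_finrank_tangentSpace _ (hg.trans (ker_aeval_sqSum_genericPoint c).symm),
      tangentSpace_genericPoint c hc hg]
    have h4 := finrank_ker_sqDiff_genericPoint c hc hg hq hliK (hak K _ haK)
    -- Rank and kernel dimension add up to r · card A, so the truncated subtraction in the statement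
    -- is exact.
    have h5 := LinearMap.finrank_range_add_finrank_ker (sqDiff c (genericPoint r (A := A)))
    rw [h4, Module.finrank_pi_fintype] at h5
    simp only [Module.finrank_pi, Finset.sum_const, Finset.card_univ, Fintype.card_fin,
      smul_eq_mul] at h5
    rw [← h5, Nat.add_sub_cancel]
  · obtain ⟨a', ha', h'⟩ := exists_open_subset_image (sqSum c (genericTuple r (A := A)))
      (b₂ * b₃) (mul_ne_zero hb₂ hb₃)
    refine ⟨a * a', by rw [map_mul]; exact mul_ne_zero haF ha', fun y hy hya => ?_⟩
    rw [map_mul] at hya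
    obtain ⟨f, hf, hfb⟩ := h' y hy (right_ne_zero_of_mul hya)
    have hfy : sqSum c (fun i a => f (i, a)) = y := by
      funext β
      rw [← hf β, ← aeval_sqSum_genericTuple c]
    rw [map_mul] at hfb
    have hli := h₂ ℂ (fun i a => f (i, a)) (left_ne_zero_of_mul hfb)
    have hqf := h₃ ℂ (fun i a => f (i, a)) (right_ne_zero_of_mul hfb)
    refine ⟨_, hfy, hli, fun h hh => sqSum_identifiable c hc hg hli hqf ?_ h (hh.trans hfy.symm)⟩
    rw [hfy]
    exact hak ℂ y (left_ne_zero_of_mul hya)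

end Identifiability

/-! ### Zariski closures of images of polynomial maps -/

section ZariskiLemmas

variable {E : Type} [AddCommGroup E] [Module ℂ E]

theorem mem_idealOf {X : Set E} {p : MvPolynomial (Module.Dual ℂ E) ℂ} :
    p ∈ idealOf X ↔ ∀ x ∈ X, eval (linCoords x) p = 0 := by
  simp [idealOf]

theorem subset_zariskiClosure (X : Set E) : X ⊆ zariskiClosure X :=
  fun x hx _ hp => mem_idealOf.1 hp x hx

theorem idealOf_zariskiClosure (X : Set E) : idealOf (zariskiClosure X) = idealOf X := by
  ext p
  rw [mem_idealOf, mem_idealOf]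
  exact ⟨fun h x hx => h x (subset_zariskiClosure X hx), fun h x hx => hx p (mem_idealOf.2 h)⟩

/-- Polynomial functions have one variable for every linear form; renaming along chosen coordinates
is the passage from ordinary coordinate polynomials. -/
theorem eval_linCoords_rename {σ : Type} (ℓ : σ → Module.Dual ℂ E) (q : MvPolynomial σ ℂ) (x : E) :
    eval (linCoords x) (rename ℓ q) = aeval (fun s => ℓ s x) q := by
  rw [eval_rename]
  rfl

theorem isZariskiClosed_zeros (q : MvPolynomial (Module.Dual ℂ E) ℂ) :
    IsZariskiClosed {x : E | eval (linCoords x) q = 0} :=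
  Set.Subset.antisymm (fun _ hx => hx q (mem_idealOf.2 fun _ h => h)) (subset_zariskiClosure _)

theorem isZariskiClosed_empty : IsZariskiClosed (∅ : Set E) := by
  simpa using isZariskiClosed_zeros (1 : MvPolynomial (Module.Dual ℂ E) ℂ)

theorem forGeneral_of_forall {X : Set E} {P : E → Prop} (h : ∀ x ∈ X, P x) : ForGeneral X P :=
  ⟨∅, isZariskiClosed_empty, by simpa using subset_zariskiClosure X, fun x hx => h x hx.1⟩

/-- Density of the locus q ≠ 0: if p vanishes there, then pq vanishes on X, and primality gives p.
-/
theorem forGeneral_of_isPrime {X : Set E} (hX : (idealOf X).IsPrime)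
    {q : MvPolynomial (Module.Dual ℂ E) ℂ} (hq : q ∉ idealOf X) {P : E → Prop}
    (h : ∀ x ∈ X, eval (linCoords x) q ≠ 0 → P x) : ForGeneral X P := by
  refine ⟨_, isZariskiClosed_zeros q, fun x hx p hp => ?_, fun x hx => h x hx.1 hx.2⟩
  have : p * q ∈ idealOf X := mem_idealOf.2 fun y hy => by
    rw [map_mul]
    by_cases hyq : eval (linCoords y) q = 0
    · rw [hyq, mul_zero]
    · rw [mem_idealOf.1 hp y ⟨hy, hyq⟩, zero_mul]
  exact mem_idealOf.1 ((hX.mem_or_mem this).resolve_right hq) x hx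

/-- If `θ` describes the pullback of polynomial functions along `Φ`, then its kernel is the ideal of
the image of `Φ`. -/
theorem idealOf_range {τ : Type} (Φ : (τ → ℂ) → E)
    (θ : MvPolynomial (Module.Dual ℂ E) ℂ →ₐ[ℂ] MvPolynomial τ ℂ)
    (h : ∀ t p, eval t (θ p) = eval (linCoords (Φ t)) p) :
    idealOf (Set.range Φ) = RingHom.ker θ := by
  ext p
  rw [mem_idealOf, RingHom.mem_ker, Set.forall_mem_range]
  simp only [← h]
  exact ⟨fun h0 => MvPolynomial.funext fun t => by rw [h0, map_zero], fun h0 t => by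
    rw [h0, map_zero]⟩

end ZariskiLemmas

/-! ### From coordinates to a symmetric bilinear map of vector spaces -/

section Abstract

variable {V W : Type} [AddCommGroup V] [Module ℂ V] [AddCommGroup W] [Module ℂ W]
  (μ : V →ₗ[ℂ] V →ₗ[ℂ] W) {A ι : Type} [Fintype A] [Fintype ι]
  (t : Module.Basis A ℂ V) (w : Module.Basis ι ℂ W)

/-- The structure constants of a bilinear map with respect to bases. -/
def structureConstants (a b : A) : ι → ℂ := w.equivFun (μ (t a) (t b))

theorem bilin_structureConstants (u v : A → ℂ) :
    bilin (structureConstants μ t w) u v =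
      w.equivFun (μ (t.equivFun.symm u) (t.equivFun.symm v)) := by
  ext β
  simp only [bilin_apply, structureConstants, Module.Basis.equivFun_symm_apply, map_sum,
    LinearMap.sum_apply, map_smul, LinearMap.smul_apply, Finset.sum_apply, Pi.smul_apply,
    smul_eq_mul, Algebra.algebraMap_self, RingHom.id_apply, Finset.mul_sum]
  rw [Finset.sum_comm]
  exact Finset.sum_congr rfl fun a _ => Finset.sum_congr rfl fun b _ => by ring

theorem sqSum_structureConstants {r : ℕ} (f : Fin r → A → ℂ) :
    sqSum (structureConstants μ t w) f =
      w.equivFun (∑ i, μ (t.equivFun.symm (f i)) (t.equivFun.symm (f i))) := by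
  simp [sqSum, bilin_structureConstants]

theorem span_structureConstants (hspan : Submodule.span ℂ (Set.range fun q : V × V => μ q.1 q.2) = ⊤) :
    Submodule.span ℂ (Set.range fun ab : A × A => structureConstants μ t w ab.1 ab.2) = ⊤ := by
  classical
  have h1 : Submodule.span ℂ (Set.range fun ab : A × A => μ (t ab.1) (t ab.2)) = ⊤ := by
    rw [eq_top_iff, ← hspan, Submodule.span_le]
    rintro _ ⟨⟨u, v⟩, rfl⟩
    change μ u v ∈ _
    rw [← t.sum_repr u, ← t.sum_repr v]
    simp only [map_sum, LinearMap.sum_apply, map_smul, LinearMap.smul_apply]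
    refine Submodule.sum_mem _ fun a _ => Submodule.smul_mem _ _ (Submodule.sum_mem _ fun b _ =>
      Submodule.smul_mem _ _ (Submodule.subset_span ?_))
    exact ⟨(b, a), rfl⟩
  have h2 : (Set.range fun ab : A × A => structureConstants μ t w ab.1 ab.2) =
      w.equivFun.toLinearMap '' (Set.range fun ab : A × A => μ (t ab.1) (t ab.2)) := by
    rw [← Set.range_comp]
    rfl
  rw [h2, Submodule.span_image, h1, Submodule.map_top, LinearEquiv.range]

variable {r : ℕ}

theorem equivFun_symm_mem_iSup_range (f : Fin r → V) {y : ι → ℂ}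
    (hy : y ∈ LinearMap.range (sqDiff (structureConstants μ t w) fun i => t.equivFun (f i))) :
    w.equivFun.symm y ∈ ⨆ i, LinearMap.range (μ (f i)) := by
  obtain ⟨v, rfl⟩ := hy
  rw [sqDiff_apply, map_sum]
  refine Submodule.sum_mem _ fun i _ => Submodule.mem_iSup_of_mem i ?_
  simp only [bilin_structureConstants, LinearEquiv.symm_apply_apply]
  exact ⟨_, rfl⟩

/-- The sum of the squares of vectors given by their coordinates. -/
def sqMap (x : Fin r × A → ℂ) : W :=
  ∑ i, μ (t.equivFun.symm fun a => x (i, a)) (t.equivFun.symm fun a => x (i, a))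

theorem range_sqMap : Set.range (sqMap (r := r) μ t) =
    Set.range fun f : Fin r → V => ∑ i, μ (f i) (f i) := by
  ext y
  constructor
  · rintro ⟨x, rfl⟩
    exact ⟨_, rfl⟩
  · rintro ⟨f, rfl⟩
    exact ⟨fun x => t.equivFun (f x.1) x.2, by simp [sqMap]⟩

/-- Pullback of polynomial functions along `sqMap`. -/
def sqPullback (r : ℕ) : MvPolynomial (Module.Dual ℂ W) ℂ →ₐ[ℂ] MvPolynomial (Fin r × A) ℂ :=
  aeval fun ψ => ∑ β, ψ (w β) • sqSum (structureConstants μ t w) (genericTuple r) β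

theorem eval_sqPullback (x : Fin r × A → ℂ) (p : MvPolynomial (Module.Dual ℂ W) ℂ) :
    eval x (sqPullback μ t w r p) = eval (linCoords (sqMap μ t x)) p := by
  have : (aeval (R := ℂ) x).comp (sqPullback μ t w r) = aeval (linCoords (sqMap μ t x)) := by
    apply MvPolynomial.algHom_ext
    intro ψ
    rw [AlgHom.comp_apply, sqPullback, aeval_X, aeval_X, map_sum, linCoords]
    have h1 : ∀ β, aeval x (sqSum (structureConstants μ t w) (genericTuple r) β) =
        w.equivFun (sqMap μ t x) β := fun β => by
      have h2 := aeval_sqSum_genericTuple (structureConstants μ t w) (fun i a => x (i, a)) β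
      rw [sqSum_structureConstants] at h2
      exact h2
    simp only [map_smul, h1]
    have e := congrArg ψ (w.sum_equivFun (sqMap μ t x))
    rw [map_sum] at e
    rw [← e]
    exact Finset.sum_congr rfl fun β _ => by rw [map_smul, smul_eq_mul, smul_eq_mul, mul_comm]
  exact DFunLike.congr_fun this p

theorem sqPullback_rename (p : MvPolynomial ι ℂ) :
    sqPullback μ t w r (rename w.coord p) =
      aeval (sqSum (structureConstants μ t w) (genericTuple r)) p := by
  classical
  rw [sqPullback, aeval_rename]
  congr 2
  funext β
  simp [Module.Basis.coord_apply, Finsupp.single_apply]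

theorem idealOf_sqSums : idealOf (zariskiClosure (Set.range fun f : Fin r → V => ∑ i, μ (f i) (f i))) =
    RingHom.ker (sqPullback μ t w r) := by
  rw [idealOf_zariskiClosure, ← range_sqMap μ t, idealOf_range _ _ (eval_sqPullback μ t w)]

/-- Pullback identifies the coordinate ring of the closure with the subalgebra generated by the
coordinates of the generic sum of squares. -/
theorem affineDim_sqSums :
    affineDim (zariskiClosure (Set.range fun f : Fin r → V => ∑ i, μ (f i) (f i))) =
      Algebra.trdeg ℂ (Algebra.adjoin ℂ (Set.range
        (sqSum (structureConstants μ t w) (genericPoint r (A := A))))) := by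
  let K := FractionRing (MvPolynomial (Fin r × A) ℂ)
  let θ := (Algebra.algHom ℂ (MvPolynomial (Fin r × A) ℂ) K).comp (sqPullback μ t w r)
  have hker : idealOf (zariskiClosure (Set.range fun f : Fin r → V => ∑ i, μ (f i) (f i))) =
      RingHom.ker θ := by
    rw [idealOf_sqSums μ t w]
    ext p
    exact (map_eq_zero_iff _ (IsFractionRing.injective (MvPolynomial (Fin r × A) ℂ) K)).symm
  have hθ : θ = aeval fun ψ => ∑ β, ψ (w β) • sqSum (structureConstants μ t w) (genericPoint r) β := by
    apply MvPolynomial.algHom_ext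
    intro ψ
    simp only [θ, AlgHom.comp_apply, sqPullback, aeval_X, map_sum, map_smul]
    exact Finset.sum_congr rfl fun β _ => congrArg _ (map_sqSum_genericTuple _ β)
  have hrange : θ.range = Algebra.adjoin ℂ (Set.range
        (sqSum (structureConstants μ t w) (genericPoint r (A := A)))) := by
    apply le_antisymm
    · rw [hθ, ← Algebra.adjoin_range_eq_range_aeval]
      refine Algebra.adjoin_le ?_
      rintro _ ⟨ψ, rfl⟩
      exact Subalgebra.sum_mem _ fun β _ => Subalgebra.smul_mem _
        (Algebra.subset_adjoin (Set.mem_range_self β)) _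
    · refine Algebra.adjoin_le ?_
      rintro _ ⟨β, rfl⟩
      refine ⟨rename w.coord (X β), ?_⟩
      change algebraMap _ K (sqPullback μ t w r (rename w.coord (X β))) = _
      rw [sqPullback_rename, aeval_X, map_sqSum_genericTuple]
  rw [affineDim, hker, (Ideal.quotientKerEquivRange θ).trdeg_eq, hrange]

/-- The polynomial functions vanishing on all tuples form a prime ideal, which contains no nonzero
polynomial in the coordinates. -/
theorem isPrime_idealOf_univ_tuples : (idealOf (Set.univ : Set (Fin r → V))).IsPrime ∧
    ∀ b : MvPolynomial (Fin r × A) ℂ, b ≠ 0 →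
      rename (fun x : Fin r × A => (t.coord x.2).comp (LinearMap.proj x.1)) b ∉
        idealOf (Set.univ : Set (Fin r → V)) := by
  classical
  let Φ : (Fin r × A → ℂ) → (Fin r → V) := fun x i => t.equivFun.symm fun a => x (i, a)
  have hΦ : Set.range Φ = Set.univ := by
    rw [Set.eq_univ_iff_forall]
    intro f
    refine Set.mem_range.2 ⟨fun x : Fin r × A => t.equivFun (f x.1) x.2, funext fun i => ?_⟩
    exact t.equivFun.symm_apply_apply (f i)
  let θ : MvPolynomial (Module.Dual ℂ (Fin r → V)) ℂ →ₐ[ℂ] MvPolynomial (Fin r × A) ℂ :=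
    aeval fun ψ => ∑ x : Fin r × A, ψ (Pi.single x.1 (t x.2)) • X x
  have hθ : ∀ x p, eval x (θ p) = eval (linCoords (Φ x)) p := by
    intro x p
    have : (aeval (R := ℂ) x).comp θ = aeval (linCoords (Φ x)) := by
      apply MvPolynomial.algHom_ext
      intro ψ
      rw [AlgHom.comp_apply, aeval_X, aeval_X, map_sum, linCoords]
      have h1 : Φ x = ∑ q : Fin r × A, x q • Pi.single q.1 (t q.2) := by
        rw [Fintype.sum_prod_type]
        ext i
        simp [Φ, Finset.sum_apply, Pi.single_apply, Module.Basis.equivFun_symm_apply]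
      rw [h1]
      simp [mul_comm]
    exact DFunLike.congr_fun this p
  have hker := idealOf_range Φ θ hθ
  rw [hΦ] at hker
  refine ⟨hker ▸ RingHom.ker_isPrime _, fun b hb h => hb ?_⟩
  rw [mem_idealOf] at h
  refine MvPolynomial.funext fun x => ?_
  have := h (Φ x) trivial
  rw [eval_linCoords_rename] at this
  rw [map_zero, ← this]
  change aeval x b = _
  congr 2
  funext q
  exact (congrFun (t.equivFun.apply_symm_apply fun a => x (q.1, a)) q.2).symm

/-- Dimension and generic orthogonal identifiability of sums of `r` squares, for an arbitrary
symmetric bilinear multiplication. -/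
theorem forGeneral_identifiable [FiniteDimensional ℂ V] [FiniteDimensional ℂ W]
    (hμ : ∀ u v, μ u v = μ v u)
    (hspan : Submodule.span ℂ (Set.range fun q : V × V => μ q.1 q.2) = ⊤)
    (hr : r ≤ Module.finrank ℂ V) :
    ForGeneral (Set.univ : Set (Fin r → V)) fun f₀ => (⨆ i, LinearMap.range (μ (f₀ i))) ≠ ⊤ →
      (∀ U : Submodule ℂ V, (∀ u ∈ U, ∀ v, μ u v ∈ ⨆ i, LinearMap.range (μ (f₀ i))) →
        Module.finrank ℂ U ≤ r) →
      affineDim (zariskiClosure (Set.range fun f : Fin r → V => ∑ i, μ (f i) (f i))) =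
        ((r * Module.finrank ℂ V - r.choose 2 : ℕ) : Cardinal) ∧
      ForGeneral (zariskiClosure (Set.range fun f : Fin r → V => ∑ i, μ (f i) (f i))) fun y =>
        ∃ f : Fin r → V, ∑ i, μ (f i) (f i) = y ∧ LinearIndependent ℂ f ∧
          ∀ h : Fin r → V, ∑ i, μ (h i) (h i) = y →
            ∃ B ∈ Matrix.orthogonalGroup (Fin r) ℂ, ∀ i, h i = ∑ j, B i j • f j := by
  let t := Module.finBasis ℂ V
  let w := Module.finBasis ℂ W
  let c := structureConstants μ t w
  have hc : ∀ a b, c a b = c b a := fun a b => by simp only [c, structureConstants, hμ (t a)]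
  obtain ⟨b, hb, h⟩ := exists_generic_identifiable c hc (span_structureConstants μ t w hspan)
    (r := r) (by simpa using hr)
  obtain ⟨hprime, hnot⟩ := isPrime_idealOf_univ_tuples (r := r) t
  refine forGeneral_of_isPrime hprime (hnot b hb) fun f₀ _ hf₀ htop hU => ?_
  rw [eval_linCoords_rename] at hf₀
  have htop' : LinearMap.range (sqDiff c fun i => t.equivFun (f₀ i)) ≠ ⊤ := fun h0 => by
    apply htop
    rw [eq_top_iff]
    intro y _
    have := equivFun_symm_mem_iSup_range μ t w f₀ (y := w.equivFun y) (by
      change _ ∈ LinearMap.range (sqDiff c fun i => t.equivFun (f₀ i))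
      rw [h0]
      trivial)
    simpa using this
  have hU' : ∀ U : Submodule ℂ (Fin (Module.finrank ℂ V) → ℂ), (∀ u ∈ U, ∀ v, bilin c u v ∈
      LinearMap.range (sqDiff c fun i => t.equivFun (f₀ i))) → Module.finrank ℂ U ≤ r := by
    intro U hU'
    have h1 := hU (U.map t.equivFun.symm.toLinearMap) (by
      rintro _ ⟨u, hu, rfl⟩ v
      have := equivFun_symm_mem_iSup_range μ t w f₀ (hU' u hu (t.equivFun v))
      rw [bilin_structureConstants] at this
      simpa using this)
    rwa [LinearEquiv.finrank_map_eq] at h1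
  obtain ⟨hdim, a, ha, hid⟩ := h (fun i => t.equivFun (f₀ i)) hf₀ htop' hU'
  refine ⟨by rw [affineDim_sqSums μ t w, hdim, Fintype.card_fin], ?_⟩
  have hI := idealOf_sqSums (r := r) μ t w
  refine forGeneral_of_isPrime (q := rename w.coord a) (hI ▸ RingHom.ker_isPrime _) ?_ ?_
  · rw [hI, RingHom.mem_ker, sqPullback_rename]
    exact ha
  intro y hy hya
  rw [eval_linCoords_rename] at hya
  have hy' : ∀ p : MvPolynomial (Fin (Module.finrank ℂ W)) ℂ,
      aeval (sqSum c (genericTuple r)) p = 0 → aeval (w.equivFun y) p = 0 := fun p hp => by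
    have h1 : rename w.coord p ∈ idealOf (zariskiClosure
        (Set.range fun f : Fin r → V => ∑ i, μ (f i) (f i))) := by
      rw [hI, RingHom.mem_ker, sqPullback_rename]
      exact hp
    have h2 := mem_idealOf.1 h1 y hy
    rw [eval_linCoords_rename] at h2
    exact h2
  obtain ⟨f, hf, hli, hf'⟩ := hid (w.equivFun y) hy' hya
  refine ⟨fun i => t.equivFun.symm (f i), ?_, ?_, fun g hg => ?_⟩
  · apply w.equivFun.injective
    rw [← hf, sqSum_structureConstants]
  · exact hli.map' t.equivFun.symm.toLinearMap (LinearEquiv.ker _)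
  · obtain ⟨B, hB, hBg⟩ := hf' (fun i => t.equivFun (g i)) (by
      rw [sqSum_structureConstants, ← hg]
      simp)
    refine ⟨B, hB, fun i => ?_⟩
    rw [← t.equivFun.symm_apply_apply (g i), hBg i]
    simp

end Abstract

/-! ### Products of forms and identifiability of forms -/

section FormsProduct

variable {n d : ℕ}

/-- Multiplication of forms of degree `d / 2`, for even `d`. -/
def formsMul (n : ℕ) {d : ℕ} (hd : Even d) :
    Forms n (d / 2) →ₗ[ℂ] Forms n (d / 2) →ₗ[ℂ] Forms n d :=
  LinearMap.mk₂ ℂ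
    (fun u v => ⟨u * v, by
      have h := (mem_homogeneousSubmodule _ _).1 u.2
      have h' := h.mul ((mem_homogeneousSubmodule _ _).1 v.2)
      rw [← two_mul, Nat.two_mul_div_two_of_even hd] at h'
      exact (mem_homogeneousSubmodule _ _).2 h'⟩)
    (fun u u' v => Subtype.ext (add_mul _ _ _))
    (fun z u v => Subtype.ext (smul_mul_assoc _ _ _))
    (fun u v v' => Subtype.ext (mul_add _ _ _))
    (fun z u v => Subtype.ext (mul_smul_comm _ _ _))

theorem coe_formsMul (hd : Even d) (u v : Forms n (d / 2)) :
    (formsMul n hd u v : MvPolynomial (Fin (n + 1)) ℂ) = u * v := rfl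

theorem span_formsMul (hd : Even d) : Submodule.span ℂ (Set.range fun q :
    Forms n (d / 2) × Forms n (d / 2) => formsMul n hd q.1 q.2) = ⊤ := by
  have h1 : Forms n (d / 2) * Forms n (d / 2) = Forms n d := by
    -- Forms of degree k are the k-th power of the space of linear forms, so degrees add under
    -- products of these spaces.
    have e : ∀ k, Forms n k = Forms n 1 ^ k := fun k => (homogeneousSubmodule_one_pow _ k).symm
    rw [e (d / 2), e d, ← pow_add, ← two_mul, Nat.two_mul_div_two_of_even hd]
  have h2 : ∀ p ∈ Forms n (d / 2) * Forms n (d / 2), p ∈ (Submodule.span ℂ (Set.range fun q :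
      Forms n (d / 2) × Forms n (d / 2) => formsMul n hd q.1 q.2)).map (Forms n d).subtype := by
    intro p hp
    induction hp using Submodule.mul_induction_on' with
    | mem_mul_mem u hu v hv =>
      exact ⟨formsMul n hd ⟨u, hu⟩ ⟨v, hv⟩, Submodule.subset_span ⟨(⟨u, hu⟩, ⟨v, hv⟩), rfl⟩, rfl⟩
    | add p _ q _ hp hq => exact Submodule.add_mem _ hp hq
  rw [eq_top_iff]
  rintro F -
  obtain ⟨G, hG, hGF⟩ := h2 F.1 (h1.symm ▸ F.2)
  rwa [← Subtype.ext hGF]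

theorem finiteDimensional_forms (n k : ℕ) : FiniteDimensional ℂ (Forms n k) :=
  Module.Finite.iff_fg.2 (homogeneousSubmodule_fg _ _ k)

theorem isDecomposition_iff (hd : Even d) {r : ℕ} (F : Forms n d) (g : Fin r → Forms n (d / 2)) :
    IsDecomposition F g ↔ ∑ i, formsMul n hd (g i) (g i) = F := by
  rw [IsDecomposition, Subtype.ext_iff, Submodule.coe_sum, eq_comm]
  simp only [coe_formsMul, pow_two]

theorem sumsOfSquares_eq_range (hd : Even d) (r : ℕ) : sumsOfSquares n d r =
    Set.range fun f : Fin r → Forms n (d / 2) => ∑ i, formsMul n hd (f i) (f i) := by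
  ext F
  simp only [sumsOfSquares, isDecomposition_iff hd]
  rfl

/-- One independent decomposition `f` with all others in its orbit suffices. Two decompositions Bf
and Cf differ by CBᵀ. A shorter decomposition padded by zeros would be Bf with, by independence, a
zero row in B, which orthogonality forbids. -/
theorem isOrthIdentifiable_of_exists (hd : Even d) {r : ℕ} {F : Forms n d}
    (h : ∃ f : Fin r → Forms n (d / 2), ∑ i, formsMul n hd (f i) (f i) = F ∧
      LinearIndependent ℂ f ∧ ∀ h : Fin r → Forms n (d / 2), ∑ i, formsMul n hd (h i) (h i) = F →
        ∃ B ∈ Matrix.orthogonalGroup (Fin r) ℂ, ∀ i, h i = ∑ j, B i j • f j) :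
    IsOrthIdentifiable r F := by
  obtain ⟨f, hf, hli, hid⟩ := h
  refine ⟨⟨⟨f, (isDecomposition_iff hd F f).2 hf⟩, ?_⟩, fun g h hg hh => ?_⟩
  · rintro s ⟨g, hg⟩
    by_contra! hsr
    rw [isDecomposition_iff hd] at hg
    let g' : Fin r → Forms n (d / 2) := fun i => if hi : (i : ℕ) < s then g ⟨i, hi⟩ else 0
    have hg' : ∑ i, formsMul n hd (g' i) (g' i) = F := by
      rw [← hg]
      refine (Fintype.sum_of_injective (Fin.castLE hsr.le) (Fin.castLE_injective _) _ _
        (fun i hi => ?_) (fun i => ?_)).symm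
      · have : ¬ (i : ℕ) < s := fun h => hi ⟨⟨i, h⟩, rfl⟩
        simp [g', this]
      · simp [g']
    obtain ⟨B, hB, hBg⟩ := hid g' hg'
    rw [Matrix.mem_orthogonalGroup_iff] at hB
    -- The first padded position, where `g'` is zero.
    let i₀ : Fin r := ⟨s, hsr⟩
    have h0 : ∑ j, B i₀ j • f j = 0 := by
      rw [← hBg]
      simp [g', i₀]
    have h1 := Fintype.linearIndependent_iff.1 hli _ h0
    have h2 := congrFun (congrFun hB i₀) i₀
    simp [Matrix.mul_apply, h1] at h2
  · rw [isDecomposition_iff hd] at hg hh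
    obtain ⟨B, hB, hBg⟩ := hid g hg
    obtain ⟨C, hC, hCh⟩ := hid h hh
    rw [Matrix.mem_orthogonalGroup_iff'] at hB
    rw [Matrix.mem_orthogonalGroup_iff] at hC
    have hf' : ∀ j, f j = ∑ k, B k j • g k := fun j => by
      have : ∀ k, B k j • g k = ∑ l, (B k j * B k l) • f l := fun k => by
        rw [hBg, Finset.smul_sum]
        simp only [smul_smul]
      simp only [this]
      rw [Finset.sum_comm]
      have h3 : ∀ l, ∑ k, (B k j * B k l) • f l = (1 : Matrix (Fin r) (Fin r) ℂ) j l • f l :=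
        fun l => by
          rw [← hB, Matrix.mul_apply, Finset.sum_smul]
          rfl
      simp only [h3]
      simp [Matrix.one_apply]
    refine ⟨C * B.transpose, ?_, fun i => ?_⟩
    · rw [Matrix.mem_orthogonalGroup_iff, Matrix.transpose_mul, Matrix.transpose_transpose,
        Matrix.mul_assoc, ← Matrix.mul_assoc B.transpose, hB, Matrix.one_mul, hC]
    · rw [hCh]
      simp only [Matrix.mul_apply, Matrix.transpose_apply, Finset.sum_smul]
      rw [Finset.sum_comm]
      refine Finset.sum_congr rfl fun j _ => ?_
      rw [hf' j, Finset.smul_sum]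
      simp only [smul_smul]

end FormsProduct

/-! ### The stacked Hessian matrix -/

section Hessian

variable {n d r : ℕ}

theorem apolar_monomial (H : MvPolynomial (Fin (n + 1)) ℂ) (α : Fin (n + 1) →₀ ℕ) :
    apolar n H (monomial α 1) = ((∏ i, (α i).factorial : ℕ) : ℂ) * coeff α H := by
  have : (apolar n).flip (monomial α 1) =
      ((∏ i, (α i).factorial : ℕ) : ℂ) • MvPolynomial.lcoeff ℂ α := by
    apply (MvPolynomial.basisMonomials (Fin (n + 1)) ℂ).ext
    intro β
    rw [LinearMap.flip_apply, apolar, Module.Basis.constr_basis]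
    by_cases h : α = β
    · subst h
      simp [lcoeff]
    · simp [lcoeff, coeff_monomial, h, Ne.symm h]
  exact DFunLike.congr_fun this H

theorem mem_idealPart (f : Fin r → Forms n (d / 2)) (i : Fin r) (v : Forms n (d / 2)) :
    (f i * v : MvPolynomial (Fin (n + 1)) ℂ) ∈ idealPart f :=
  Submodule.mem_iSup_of_mem i ⟨v, v.2, rfl⟩

theorem coe_mem_idealPart (hd : Even d) (f : Fin r → Forms n (d / 2)) {F : Forms n d}
    (hF : F ∈ ⨆ i, LinearMap.range (formsMul n hd (f i))) :
    (F : MvPolynomial (Fin (n + 1)) ℂ) ∈ idealPart f := by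
  have : (⨆ i, LinearMap.range (formsMul n hd (f i))) ≤ (idealPart f).comap (Forms n d).subtype := by
    refine iSup_le fun i => ?_
    rintro _ ⟨v, rfl⟩
    exact mem_idealPart f i v
  exact this hF

theorem apolar_eq_zero {f : Fin r → Forms n (d / 2)} {H F : MvPolynomial (Fin (n + 1)) ℂ}
    (hH : H ∈ apolarPerp f) (hF : F ∈ idealPart f) : apolar n H F = 0 :=
  (Submodule.mem_dualAnnihilator _).1 hH.2 F hF

/-- The apolar product is nondegenerate on forms of degree d: a form orthogonal to every monomial
x^α of that degree has α! times each of its coefficients equal to zero. -/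
theorem iSup_range_ne_top (hd : Even d) (f : Fin r → Forms n (d / 2))
    {H : MvPolynomial (Fin (n + 1)) ℂ} (hH : H ∈ apolarPerp f) (hH0 : H ≠ 0) :
    (⨆ i, LinearMap.range (formsMul n hd (f i))) ≠ ⊤ := by
  intro htop
  apply hH0
  ext α
  rw [coeff_zero]
  by_contra h
  have hα : α.degree = d := by
    have := (mem_homogeneousSubmodule _ _).1 hH.1 h
    rwa [Finsupp.degree_eq_weight_one (R := ℕ)]
  have hF : monomial α (1 : ℂ) ∈ Forms n d :=
    (mem_homogeneousSubmodule _ _).2 (isHomogeneous_monomial _ hα)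
  have h1 := apolar_eq_zero hH (coe_mem_idealPart hd f (F := ⟨_, hF⟩) (htop ▸ Submodule.mem_top))
  rw [apolar_monomial] at h1
  refine mul_ne_zero ?_ h h1
  rw [Nat.cast_ne_zero]
  exact Finset.prod_ne_zero_iff.2 fun i _ => Nat.factorial_ne_zero _

/-- If every multiple of u lies in I_d, it is orthogonal to every H_p, so the coordinates of u lie
in the left kernel of the stacked Hessian, of dimension N − (N − r). -/
theorem finrank_le_of_rank_stackedHessian (hd : Even d) {N m : ℕ} {f : Fin r → Forms n (d / 2)}
    (t : Module.Basis (Fin N) ℂ (Forms n (d / 2))) (H : Module.Basis (Fin m) ℂ (apolarPerp f))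
    (hrank : ((stackedHessian t H).rank : ℤ) = (N : ℤ) - (r : ℤ))
    (U : Submodule ℂ (Forms n (d / 2)))
    (hU : ∀ u ∈ U, ∀ v, formsMul n hd u v ∈ ⨆ i, LinearMap.range (formsMul n hd (f i))) :
    Module.finrank ℂ U ≤ r := by
  have h1 := finrank_ker_mulVecLin_add_rank (stackedHessian t H).transpose
  rw [Matrix.rank_transpose, Fintype.card_fin] at h1
  have h2 : U.map t.equivFun.toLinearMap ≤
      LinearMap.ker (stackedHessian t H).transpose.mulVecLin := by
    rintro _ ⟨u, hu, rfl⟩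
    rw [LinearMap.mem_ker]
    ext ⟨p, j⟩
    have h3 := apolar_eq_zero (H p).2 (coe_mem_idealPart hd f (hU u hu (t j)))
    rw [coe_formsMul] at h3
    rw [Pi.zero_apply, ← h3]
    have h4 := congrArg (fun v : Forms n (d / 2) =>
      apolar n (H p) ((v : MvPolynomial (Fin (n + 1)) ℂ) * t j)) (t.sum_equivFun u)
    simp only [Submodule.coe_sum, Submodule.coe_smul, Finset.sum_mul, smul_mul_assoc, map_sum,
      map_smul, smul_eq_mul] at h4
    rw [← h4]
    change ∑ i, apolar n (H p) (t i * t j) * t.equivFun u i = _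
    exact Finset.sum_congr rfl fun i _ => mul_comm _ _
  have h3 := Submodule.finrank_mono h2
  rw [LinearEquiv.finrank_map_eq] at h3
  omega

end Hessian

end SumsOfSquares

end

/-! ### The theorem for forms -/

theorem mainTheorem2 (n d r N : ℕ) (hd : Even d) (hN : N = (n + d / 2).choose n) :
    SumsOfSquares.ForGeneral (Set.univ : Set (Fin r → SumsOfSquares.Forms n (d / 2))) (fun f =>
      ∀ (m : ℕ) (_ : 1 ≤ m)
        (t : Module.Basis (Fin N) ℂ (SumsOfSquares.Forms n (d / 2)))
        (H : Module.Basis (Fin m) ℂ (SumsOfSquares.apolarPerp f)),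
        ((SumsOfSquares.stackedHessian t H).rank : ℤ) = (N : ℤ) - (r : ℤ) →
        SumsOfSquares.affineDim (SumsOfSquares.secantVariety n d r) =
            ((r * N - r.choose 2 : ℕ) : Cardinal) ∧
          SumsOfSquares.IsGenericallyOrthIdentifiable n d r) := by
  have := SumsOfSquares.finiteDimensional_forms n (d / 2)
  have := SumsOfSquares.finiteDimensional_forms n d
  by_cases hr : r ≤ Module.finrank ℂ (SumsOfSquares.Forms n (d / 2))
  · obtain ⟨Z, hZ, hdense, h⟩ := SumsOfSquares.forGeneral_identifiable
      (SumsOfSquares.formsMul n hd) (fun u v => Subtype.ext (mul_comm _ _))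
      (SumsOfSquares.span_formsMul hd) hr
    refine ⟨Z, hZ, hdense, fun f hf m hm t H hrank => ?_⟩
    have hNt : Module.finrank ℂ (SumsOfSquares.Forms n (d / 2)) = N := by
      rw [Module.finrank_eq_card_basis t, Fintype.card_fin]
    obtain ⟨hdim, Z', hZ', hdense', h'⟩ := h f hf
      (SumsOfSquares.iSup_range_ne_top hd f (H ⟨0, hm⟩).2
        fun h0 => H.ne_zero ⟨0, hm⟩ (Subtype.ext h0))
      (SumsOfSquares.finrank_le_of_rank_stackedHessian hd t H hrank)
    rw [hNt, ← SumsOfSquares.sumsOfSquares_eq_range hd] at hdim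
    rw [← SumsOfSquares.sumsOfSquares_eq_range hd] at hdense' h'
    exact ⟨hdim, Z', hZ', hdense', fun F hF => SumsOfSquares.isOrthIdentifiable_of_exists hd
      (h' F hF)⟩
  -- For r > N the required rank N − r, an integer, would be negative, so the hypothesis never
  -- holds.
  · refine SumsOfSquares.forGeneral_of_forall fun f _ m _ t H hrank => ?_
    rw [Module.finrank_eq_card_basis t, Fintype.card_fin] at hr
    omega
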